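/- Let $A\in\mathbb R^{n\times n}$ be symmetric negative definite, let $N_1,\dots,N_m\in\mathbb R^{n\times n}$ be symmetric, let $C\in\mathbb R^{r\times n}$ and $B=C^T$, and let $\Sigma$ be the bilinear system $$\dot x(t)=Ax(t)+\sum_{i=1}^m N_i x(t)w_i(t)+Bu(t),\qquad y(t)=Cx(t).$$ Put $\mathcal L(X)=AX+XA^T$, $\Pi(X)=\sum_{i=1}^m N_iXN_i^T$ and $\mathcal M=-\mathcal L-\Pi$ on $\mathbb R^{n\times n}$, and assume that the spectral radius satisfies $\rho(\mathcal L^{-1}\Pi)<1$. Let $X$ be the solution of $\mathcal L(X)+\Pi(X)+BB^T=0$, and let $\|Z\|_{\mathcal M}=\sqrt{\operatorname{trace}(Z^T\mathcal M(Z))}$. For a bilinear system with coefficients $(A,(N_i),B,C)$ the $\mathcal H_2$-norm is defined by $$\|\Sigma\|_{\mathcal H_2}^2=\operatorname{trace}\Big(\sum_{j=1}^\infty\int_0^\infty\!\!\cdots\!\int_0^\infty\sum_{\ell_1,\dots,\ell_{j-1}=1}^m g_j^{(\ell_1,\dots,\ell_{j-1})}\big(g_j^{(\ell_1,\dots,\ell_{j-1})}\big)^T\,ds_1\cdots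 ds_j\Big),$$ $$g_j^{(\ell_1,\dots,\ell_{j-1})}(s_1,\dots,s_j)=Ce^{As_j}N_{\ell_1}e^{As_{j-1}}N_{\ell_2}\cdots N_{\ell_{j-1}}e^{As_1}B,$$ with value $\infty$ if this does not converge. A system $\widehat\Sigma$ of order $k$ is called locally $\mathcal H_2$-optimal for $\Sigma$ if $\|\Sigma-\widehat\Sigma\|_{\mathcal H_2}<\infty$ and $\|\Sigma-\widehat\Sigma\|_{\mathcal H_2}\le\|\Sigma-\Sigma'\|_{\mathcal H_2}$ for all systems $\Sigma'$ of order $k$ (with the same numbers of inputs and outputs) whose coefficient matrices are sufficiently close to those of $\widehat\Sigma$. Here $\Sigma-\Sigma'$ is the error system, with coefficients $\operatorname{diag}(A,A')$, $\operatorname{diag}(N_i,N_i')$, $\begin{bmatrix}B\\B'\end{bmatrix}$, $[\,C\ \ {-C'}\,]$. Let $k<n$, let $V\in\mathbb R^{n\times k}$ satisfy $V^TV=I$, and let $\widehat\Sigma$ be the reduced system with $\hat A=V^TAV$, $\hat N_i=V^TN_iV$, $\hat B=V^TB=\hat C^T$. Let $\hat X\in\mathbb R^{k\times k}$ solve $$\hat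 A\hat X+\hat X\hat A+\sum_{i=1}^m\hat N_i\hat X\hat N_i^T+\hat B\hat B^T=0.$$ If $\widehat\Sigma$ is locally $\mathcal H_2$-optimal for $\Sigma$, then $V\hat XV^T$ is locally optimal with respect to the $\mathcal M$-norm among the matrices of rank at most $k$: there is a neighbourhood $U$ of $V\hat XV^T$ in $\mathbb R^{n\times n}$ with $$\|X-V\hat XV^T\|_{\mathcal M}\le\|X-Z\|_{\mathcal M}\qquad\text{for all }Z\in U\text{ with }\operatorname{rank}Z\le k.$$ -/

import Mathlib

open scoped ENNReal Topology

/-- A bilinear control system with states indexed by `ι`, bilinear inputs `w` indexed by `μ`, and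
inputs `u` and outputs `y` indexed by `ρ`:
`x' = A x + ∑ i, w i • N i x + B u`, `y = C x`. -/
structure BilinearSystem (ι μ ρ : Type*) where
  A : Matrix ι ι ℝ
  N : μ → Matrix ι ι ℝ
  B : Matrix ι ρ ℝ
  C : Matrix ρ ι ℝ

/-- The Lyapunov operator `X ↦ A X + X Aᵀ`. -/
def lyapunovOp {ι : Type*} [Fintype ι] (A : Matrix ι ι ℝ) : Module.End ℝ (Matrix ι ι ℝ) where
  toFun X := A * X + X * A.transpose
  map_add' X Y := by simp only [mul_add, add_mul]; abel
  map_smul' c X := by simp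

/-- The correction `X ↦ ∑ i, N i X (N i)ᵀ`. -/
def correctionOp {ι μ : Type*} [Fintype ι] [Fintype μ] (N : μ → Matrix ι ι ℝ) :
    Module.End ℝ (Matrix ι ι ℝ) where
  toFun X := ∑ i, N i * X * (N i).transpose
  map_add' X Y := by simp only [mul_add, add_mul, Finset.sum_add_distrib]
  map_smul' c X := by simp [Finset.smul_sum]

/-- The spectral radius of an endomorphism of a real vector space: the supremum of the absolute
values of its complex eigenvalues, that is, of the spectrum of its complexification. -/
noncomputable def realSpectralRadius {E : Type*} [AddCommGroup E] [Module ℝ E]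
    (T : Module.End ℝ E) : ℝ≥0∞ :=
  spectralRadius ℂ (A := Module.End ℂ (TensorProduct ℝ ℂ E)) (T.baseChange ℂ)

/-- The inner product `⟨X, Y⟩ = trace (Xᵀ M(Y))`, where `M = -(lyapunovOp A + correctionOp N)`. -/
noncomputable def energyInner {ι μ : Type*} [Fintype ι] [Fintype μ]
    (A : Matrix ι ι ℝ) (N : μ → Matrix ι ι ℝ) (X Y : Matrix ι ι ℝ) : ℝ :=
  (X.transpose * (-(lyapunovOp A Y) - correctionOp N Y)).trace

/-- The energy norm, induced by `energyInner`. -/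
noncomputable def energyNorm {ι μ : Type*} [Fintype ι] [Fintype μ]
    (A : Matrix ι ι ℝ) (N : μ → Matrix ι ι ℝ) (X : Matrix ι ι ℝ) : ℝ :=
  Real.sqrt (energyInner A N X X)

namespace BilinearSystem

variable {ι κ μ ρ : Type*}

/-- Systems with the same index types carry the topology of their coefficient matrices. -/
instance : TopologicalSpace (BilinearSystem ι μ ρ) :=
  TopologicalSpace.induced (fun S => (S.A, S.N, S.B, S.C)) inferInstance

/-- `X` solves the generalized Lyapunov equation `A X + X Aᵀ + ∑ i, N i X (N i)ᵀ + B Bᵀ = 0`. -/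
def SolvesLyapunov [Fintype ι] [Fintype μ] [Fintype ρ] (S : BilinearSystem ι μ ρ)
    (X : Matrix ι ι ℝ) : Prop :=
  lyapunovOp S.A X + correctionOp S.N X + S.B * S.B.transpose = 0

/-- The reduced system `(Vᵀ A V, Vᵀ N i V, Vᵀ B, C V)`. -/
def project [Fintype ι] (S : BilinearSystem ι μ ρ) (V : Matrix ι κ ℝ) :
    BilinearSystem κ μ ρ where
  A := V.transpose * S.A * V
  N i := V.transpose * S.N i * V
  B := V.transpose * S.B
  C := S.C * V

/-- The error system `S - S'`: both systems are driven by the same inputs, and its output is the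
difference of their outputs. -/
def error (S : BilinearSystem ι μ ρ) (S' : BilinearSystem κ μ ρ) :
    BilinearSystem (ι ⊕ κ) μ ρ where
  A := Matrix.fromBlocks S.A 0 0 S'.A
  N i := Matrix.fromBlocks (S.N i) 0 0 (S'.N i)
  B := Matrix.fromRows S.B S'.B
  C := Matrix.fromCols S.C (-S'.C)

/-- `e^{A sⱼ} N_{ℓ₀} e^{A sⱼ₋₁} N_{ℓ₁} ⋯ N_{ℓⱼ₋₁} e^{A s₀} B`. -/
noncomputable def stateKernel [Fintype ι] [DecidableEq ι] (S : BilinearSystem ι μ ρ) :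
    (j : ℕ) → (Fin j → μ) → (Fin (j + 1) → ℝ) → Matrix ι ρ ℝ
  | 0, _, s => NormedSpace.exp (s 0 • S.A) * S.B
  | j + 1, l, s =>
      NormedSpace.exp (s (Fin.last (j + 1)) • S.A) * S.N (l 0) *
        S.stateKernel j (Fin.tail l) (Fin.init s)

/-- The Volterra kernel `C e^{A sⱼ} N_{ℓ₀} ⋯ N_{ℓⱼ₋₁} e^{A s₀} B`; its columns are the kernels
that belong to the single columns of `B`. -/
noncomputable def volterraKernel [Fintype ι] [DecidableEq ι] (S : BilinearSystem ι μ ρ)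
    (j : ℕ) (l : Fin j → μ) (s : Fin (j + 1) → ℝ) : Matrix ρ ρ ℝ :=
  S.C * S.stateKernel j l s

/-- The squared `H₂`-norm: the trace of the series over `j` of the integrals over `[0, ∞)^(j+1)` of
`∑ l, g_l g_lᵀ`, where `g_l` is the Volterra kernel. All the matrices `g_l g_lᵀ` are positive
semidefinite, so the trace can be taken first, and the matrix series of integrals converges exactly
when the value is finite; the value is `∞` otherwise. -/
noncomputable def h2NormSq [Fintype ι] [DecidableEq ι] [Fintype μ] [Fintype ρ]
    (S : BilinearSystem ι μ ρ) : ℝ≥0∞ :=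
  ∑' j : ℕ, ∫⁻ s in {s : Fin (j + 1) → ℝ | ∀ i, 0 ≤ s i},
    ENNReal.ofReal
      (∑ l : Fin j → μ, (S.volterraKernel j l s * (S.volterraKernel j l s).transpose).trace)

/-- `S'` is a locally `H₂`-optimal reduced system for `S`: the `H₂`-norm of `S - S'` is finite, and
no system of the same order as `S'` with coefficients close to those of `S'` has a smaller error. -/
def IsLocallyH2Optimal [Fintype ι] [DecidableEq ι] [Fintype κ] [DecidableEq κ] [Fintype μ]
    [Fintype ρ] (S : BilinearSystem ι μ ρ) (S' : BilinearSystem κ μ ρ) : Prop :=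
  (S.error S').h2NormSq ≠ ∞ ∧
    IsLocalMin (fun T : BilinearSystem κ μ ρ => (S.error T).h2NormSq) S'

end BilinearSystem

/-! Write M for the operator of a pair of systems and F for the product of their input matrices.
Below the spectral radius bound, M is positive definite (`positive_of_realSpectralRadius_lt_one`),
so a solution of M Y = F maximizes 2⟨W, F⟩ − ⟨W, M W⟩, with value ⟨Y, F⟩
(`Positive.two_mul_sub_le`). With B = Cᵀ the squared H₂-error is c − 2q + p (`h2NormSq_error`),
where c, q and p are these values for the full Gramian X, the cross Gramian Y and the reduced
Gramian Z.

Scaling the inputs and outputs of the reduced system shows q = p at a local optimum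
(`frob_eq_of_isLocalMin`). For a projection by V, q − p is the energy of Y − V Z, so Y = V Z.

Suppose Z is invertible. A matrix of rank at most k near V Z Vᵀ has the form U K Wᵀ, where U and W
have orthonormal columns and, up to a change of basis, lie near V. Its squared error is at least c −
⟨Y', F'⟩, with Y' the cross Gramian of the two projections. The H₂-distance between these
projections is nonnegative, so 2⟨Y', F'⟩ ≤ p_U + p_W; H₂-optimality gives p_U, p_W ≤ p; and c − p is
the squared error of V Z Vᵀ (`energyInner_sub_le`).

Suppose Z e = 0 with e ≠ 0. Then e is an idle state. Coupling it to the system at order t can be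
arranged to change p only at order t⁴, while q grows at order t² unless a residual vanishes
(`mulVec_add_eq_zero_of_isLocalMin`). Optimality makes all these residuals vanish, so the range of V
contains those of B and of N i V Z; this forces X = V Z Vᵀ, with error zero
(`eq_of_isLocalMin_of_singular`). -/

/-! ### The Frobenius inner product. -/

namespace Matrix

variable {ι κ σ : Type*}

/-- The Frobenius inner product `trace (Xᵀ Y)`. -/
noncomputable def frob [Fintype ι] [Fintype κ] : LinearMap.BilinForm ℝ (Matrix ι κ ℝ) :=
  LinearMap.mk₂ ℝ (fun X Y => (X.transpose * Y).trace)
    (by simp [Matrix.add_mul]) (by simp) (by simp [Matrix.mul_add]) (by simp)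

variable [Fintype ι] [Fintype κ] [Fintype σ]

theorem frob_apply (X Y : Matrix ι κ ℝ) : frob X Y = (X.transpose * Y).trace := rfl

theorem frob_eq_sum (X Y : Matrix ι κ ℝ) : frob X Y = ∑ j, ∑ i, X i j * Y i j := by
  simp [frob_apply, trace, mul_apply]

theorem frob_comm (X Y : Matrix ι κ ℝ) : frob X Y = frob Y X := by
  simp [frob_eq_sum, mul_comm]

theorem frob_transpose (X Y : Matrix ι κ ℝ) : frob X.transpose Y.transpose = frob X Y := by
  rw [frob_eq_sum, frob_eq_sum, Finset.sum_comm]; rfl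

theorem frob_mul_left (X : Matrix ι κ ℝ) (A : Matrix ι σ ℝ) (Y : Matrix σ κ ℝ) :
    frob X (A * Y) = frob (A.transpose * X) Y := by
  simp [frob_apply, Matrix.mul_assoc]

theorem frob_mul_right (X : Matrix ι κ ℝ) (Y : Matrix ι σ ℝ) (A : Matrix σ κ ℝ) :
    frob X (Y * A) = frob (X * A.transpose) Y := by
  rw [frob_apply, frob_apply, transpose_mul, transpose_transpose, ← Matrix.mul_assoc,
    Matrix.trace_mul_comm, Matrix.mul_assoc]

theorem frob_self_eq_zero {X : Matrix ι κ ℝ} (h : frob X X = 0) : X = 0 := by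
  have h' : (X.conjTranspose * X).trace = 0 := by
    rwa [conjTranspose_eq_transpose_of_trivial]
  exact Matrix.trace_conjTranspose_mul_self_eq_zero_iff.1 h'

open scoped MatrixOrder Matrix.Norms.L2Operator in
theorem PosSemidef.exists_eq_transpose_mul_self {P : Matrix ι ι ℝ} (hP : P.PosSemidef) :
    ∃ R : Matrix ι ι ℝ, P = R.transpose * R := by
  classical
  obtain ⟨R, hR⟩ := CStarAlgebra.nonneg_iff_eq_star_mul_self.mp hP.nonneg
  exact ⟨R, by rw [hR, star_eq_conjTranspose, conjTranspose_eq_transpose_of_trivial]⟩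

theorem frob_nonneg {P Q : Matrix ι ι ℝ} (hP : P.PosSemidef) (hQ : Q.PosSemidef) :
    0 ≤ frob P Q := by
  obtain ⟨R, rfl⟩ := hQ.exists_eq_transpose_mul_self
  have hPt : P.transpose = P := by simpa using hP.1.eq
  have h := (hP.mul_mul_conjTranspose_same R).trace_nonneg
  rw [Matrix.trace_mul_comm, ← Matrix.mul_assoc, Matrix.trace_mul_comm,
    conjTranspose_eq_transpose_of_trivial] at h
  rwa [frob_apply, hPt]

end Matrix

/-! ### Sylvester operators of pairs of systems. -/

open Matrix

namespace BilinearSystem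

variable {ι κ μ ρ ι' κ' : Type*} [Fintype ι] [Fintype κ] [Fintype μ] [Fintype ι'] [Fintype κ']

/-- The operator `Y ↦ -(A Y + Y A'ᵀ + ∑ i, N i Y (N' i)ᵀ)` of a pair of systems. -/
def sylvesterOp (S : BilinearSystem ι μ ρ) (T : BilinearSystem κ μ ρ) :
    Matrix ι κ ℝ →ₗ[ℝ] Matrix ι κ ℝ where
  toFun Y := -(S.A * Y + Y * T.A.transpose + ∑ i, S.N i * Y * (T.N i).transpose)
  map_add' X Y := by simp only [Matrix.mul_add, Matrix.add_mul, Finset.sum_add_distrib]; abel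
  map_smul' c X := by simp [Finset.smul_sum]

theorem sylvesterOp_apply (S : BilinearSystem ι μ ρ) (T : BilinearSystem κ μ ρ)
    (Y : Matrix ι κ ℝ) : S.sylvesterOp T Y =
      -(S.A * Y + Y * T.A.transpose + ∑ i, S.N i * Y * (T.N i).transpose) := rfl

theorem energyInner_eq_frob (S : BilinearSystem ι μ ρ) (X Y : Matrix ι ι ℝ) :
    energyInner S.A S.N X Y = frob X (S.sylvesterOp S Y) := by
  rw [energyInner, frob_apply, sylvesterOp_apply, neg_add]
  rfl

theorem solvesLyapunov_iff [Fintype ρ] (S : BilinearSystem ι μ ρ) (X : Matrix ι ι ℝ) :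
    S.SolvesLyapunov X ↔ S.sylvesterOp S X = S.B * S.B.transpose := by
  rw [SolvesLyapunov, sylvesterOp_apply, neg_eq_iff_add_eq_zero]; rfl

theorem sylvesterOp_transpose (S : BilinearSystem ι μ ρ) (T : BilinearSystem κ μ ρ)
    (Y : Matrix ι κ ℝ) :
    (S.sylvesterOp T Y).transpose = T.sylvesterOp S Y.transpose := by
  simp only [sylvesterOp_apply, transpose_neg, transpose_add, transpose_mul, transpose_sum,
    transpose_transpose, Matrix.mul_assoc]
  rw [add_comm (T.A * _)]

/-- The state matrices of the system are symmetric. -/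
structure IsSymmetric (S : BilinearSystem ι μ ρ) : Prop where
  A_symm : S.A.IsSymm
  N_symm : ∀ i, (S.N i).IsSymm

theorem frob_sylvesterOp_comm {S : BilinearSystem ι μ ρ} {T : BilinearSystem κ μ ρ}
    (hS : S.IsSymmetric) (hT : T.IsSymmetric) (X Y : Matrix ι κ ℝ) :
    frob X (S.sylvesterOp T Y) = frob (S.sylvesterOp T X) Y := by
  simp only [sylvesterOp_apply, map_neg, map_add, map_sum, LinearMap.neg_apply,
    LinearMap.add_apply, LinearMap.sum_apply]
  have hN : ∀ i, frob X (S.N i * Y * (T.N i).transpose) =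
      frob (S.N i * X * (T.N i).transpose) Y := fun i => by
    rw [frob_mul_right, frob_mul_left, (hS.N_symm i).eq, (hT.N_symm i).eq, (hT.N_symm i).eq,
      Matrix.mul_assoc]
  rw [frob_mul_left X S.A Y, frob_mul_right X Y, hS.A_symm.eq, hT.A_symm.eq, hT.A_symm.eq]
  simp only [hN]

/-- The quadratic form of `sylvesterOp` is positive definite. -/
def Positive (S : BilinearSystem ι μ ρ) (T : BilinearSystem κ μ ρ) : Prop :=
  ∀ Y : Matrix ι κ ℝ, Y ≠ 0 → 0 < frob Y (S.sylvesterOp T Y)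

variable {S : BilinearSystem ι μ ρ} {T : BilinearSystem κ μ ρ}

theorem Positive.nonneg (h : S.Positive T) (Y : Matrix ι κ ℝ) :
    0 ≤ frob Y (S.sylvesterOp T Y) := by
  rcases eq_or_ne Y 0 with rfl | hY
  · simp
  · exact (h Y hY).le

theorem Positive.eq_zero (h : S.Positive T) {Y : Matrix ι κ ℝ}
    (hY : frob Y (S.sylvesterOp T Y) ≤ 0) : Y = 0 := by
  by_contra h0
  exact absurd (h Y h0) hY.not_gt

theorem Positive.injective (h : S.Positive T) : Function.Injective (S.sylvesterOp T) :=
  (injective_iff_map_eq_zero _).2 fun Y hY => h.eq_zero (by simp [hY])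

theorem Positive.surjective (h : S.Positive T) : Function.Surjective (S.sylvesterOp T) :=
  LinearMap.injective_iff_surjective.1 h.injective

theorem Positive.symm (h : S.Positive T) : T.Positive S := fun Y hY => by
  rw [← frob_transpose, sylvesterOp_transpose]
  exact h _ (by simpa using hY)

theorem Positive.isSymm_of_solves (h : S.Positive S) {X F : Matrix ι ι ℝ} (hF : F.IsSymm)
    (hX : S.sylvesterOp S X = F) : X.IsSymm := by
  apply h.injective
  rw [← sylvesterOp_transpose, hX, hF.eq]

/-- The maximum of `2 ⟨W, F⟩ - ⟨W, M W⟩` is `⟨Y, F⟩`, where `M Y = F`. -/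
theorem Positive.two_mul_sub_le (hS : S.IsSymmetric) (hT : T.IsSymmetric) (h : S.Positive T)
    {Y F : Matrix ι κ ℝ} (hY : S.sylvesterOp T Y = F) (W : Matrix ι κ ℝ) :
    2 * frob W F - frob W (S.sylvesterOp T W) ≤ frob Y F := by
  -- Completing the square: the gap in the inequality is exactly this energy of Y − W.
  have h1 := h.nonneg (Y - W)
  have h2 := frob_sylvesterOp_comm hS hT Y W
  simp only [map_sub, LinearMap.sub_apply, hY] at h1 h2
  rw [frob_comm F W] at h2
  linarith

/-- Projection compresses the operator to the matrices U Y Wᵀ. Reduced energies are therefore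
energies in the full space, and definiteness is inherited. -/
theorem sylvesterOp_project [DecidableEq ι'] [DecidableEq κ'] {U : Matrix ι ι' ℝ}
    {W : Matrix κ κ' ℝ} (hU : U.transpose * U = 1) (hW : W.transpose * W = 1)
    (Y : Matrix ι' κ' ℝ) :
    (S.project U).sylvesterOp (T.project W) Y =
      U.transpose * S.sylvesterOp T (U * Y * W.transpose) * W := by
  have hU' : ∀ Z : Matrix ι' κ' ℝ, U.transpose * (U * Z) = Z := fun Z => by
    rw [← Matrix.mul_assoc, hU, Matrix.one_mul]
  simp [sylvesterOp_apply, project, Matrix.mul_add, Matrix.add_mul, Matrix.mul_assoc,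
    Matrix.mul_sum, Matrix.sum_mul, hW, hU']

theorem frob_sylvesterOp_project [DecidableEq ι'] [DecidableEq κ'] {U : Matrix ι ι' ℝ}
    {W : Matrix κ κ' ℝ} (hU : U.transpose * U = 1) (hW : W.transpose * W = 1)
    (X Y : Matrix ι' κ' ℝ) :
    frob X ((S.project U).sylvesterOp (T.project W) Y) =
      frob (U * X * W.transpose) (S.sylvesterOp T (U * Y * W.transpose)) := by
  rw [sylvesterOp_project hU hW, frob_mul_right, frob_mul_left, transpose_transpose,
    ← Matrix.mul_assoc]

omit [Fintype μ] in
theorem project_one [DecidableEq ι] (S : BilinearSystem ι μ ρ) : S.project 1 = S := by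
  cases S; simp [project]

omit [Fintype μ] [Fintype ι'] in
theorem IsSymmetric.project (hS : S.IsSymmetric) (U : Matrix ι ι' ℝ) :
    (S.project U).IsSymmetric where
  A_symm := by
    simp [BilinearSystem.project, IsSymm, transpose_mul, hS.A_symm.eq, Matrix.mul_assoc]
  N_symm i := by
    simp [BilinearSystem.project, IsSymm, transpose_mul, (hS.N_symm i).eq, Matrix.mul_assoc]

theorem Positive.project [DecidableEq ι'] [DecidableEq κ'] (h : S.Positive T)
    {U : Matrix ι ι' ℝ} {W : Matrix κ κ' ℝ} (hU : U.transpose * U = 1)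
    (hW : W.transpose * W = 1) : (S.project U).Positive (T.project W) := by
  intro Y hY
  rw [frob_sylvesterOp_project hU hW]
  apply h
  intro h0
  apply hY
  calc Y = U.transpose * (U * Y * W.transpose) * W := by
        simp only [Matrix.mul_assoc, hW]
        rw [← Matrix.mul_assoc, hU]; simp
    _ = 0 := by simp [h0]

/-- Test with x xᵀ: the N-terms only lower the energy, so the A-terms, −2 (x ⬝ A x)(x ⬝ x), must be
positive. Thus projected and error systems are stable without a new assumption on their spectral
radius. -/
theorem Positive.posDef_neg_A (hS : S.IsSymmetric) (h : S.Positive S) : (-S.A).PosDef := by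
  refine PosDef.of_dotProduct_mulVec_pos (by simpa [IsHermitian] using hS.A_symm.eq) fun x hx => ?_
  have h1 := h (vecMulVec x x) (by
    intro h0
    apply hx
    ext i
    simpa [vecMulVec_apply] using congrFun (congrFun h0 i) i)
  have hA : ∀ A : Matrix ι ι ℝ, frob (vecMulVec x x) (A * vecMulVec x x) =
      (x ⬝ᵥ A *ᵥ x) * (x ⬝ᵥ x) := fun A => by
    rw [frob_apply, mul_vecMulVec, transpose_vecMulVec, vecMulVec_mul_vecMulVec,
      trace_vecMulVec]
    simp
  have hA' : ∀ A : Matrix ι ι ℝ, frob (vecMulVec x x) (vecMulVec x x * A.transpose) =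
      (x ⬝ᵥ A *ᵥ x) * (x ⬝ᵥ x) := fun A => by
    rw [← hA, ← frob_transpose]; simp [transpose_mul, transpose_vecMulVec]
  have hN : ∀ i, 0 ≤ frob (vecMulVec x x) (S.N i * vecMulVec x x * (S.N i).transpose) :=
    fun i => frob_nonneg (by simpa using posSemidef_vecMulVec_self_star x)
      (by simpa using (posSemidef_vecMulVec_self_star x).mul_mul_conjTranspose_same (S.N i))
  rw [sylvesterOp_apply, map_neg, map_add, map_add, hA, hA', map_sum] at h1
  have hx' : 0 < x ⬝ᵥ x := by simpa using (dotProduct_star_self_pos_iff (v := x)).2 hx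
  have h2 := Finset.sum_nonneg fun i (_ : i ∈ Finset.univ) => hN i
  simp only [star_trivial, neg_mulVec, dotProduct_neg]
  by_contra h3
  have := mul_nonneg (neg_nonpos.1 (not_lt.1 h3)) hx'.le
  linarith

end BilinearSystem

/-! ### Definiteness from the spectral radius. -/

namespace Matrix

variable {ι κ : Type*} [Fintype ι] [Fintype κ]

theorem PosDef.frob_mul_left_pos {D : Matrix ι ι ℝ} (hD : D.PosDef) {X : Matrix ι κ ℝ}
    (hX : X ≠ 0) : 0 < frob X (D * X) := by
  have h : frob X (D * X) = ∑ j, X.col j ⬝ᵥ (D *ᵥ X.col j) := by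
    rw [frob_eq_sum]; rfl
  have h0 : ∃ j, X.col j ≠ 0 := by
    by_contra! h0
    exact hX (by ext i j; exact congrFun (h0 j) i)
  obtain ⟨j, hj⟩ := h0
  rw [h]
  exact Finset.sum_pos' (fun j _ => by
    simpa using hD.posSemidef.dotProduct_mulVec_nonneg (X.col j))
    ⟨j, Finset.mem_univ j, by simpa using hD.dotProduct_mulVec_pos hj⟩

/-- At an isotropic X of a semidefinite form, moving along −G X would make the form negative unless
G X = 0. -/
theorem eq_zero_of_frob_map_self_eq_zero {G : Matrix ι κ ℝ →ₗ[ℝ] Matrix ι κ ℝ}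
    (hG : ∀ X Y, frob X (G Y) = frob (G X) Y) (hG' : ∀ X, 0 ≤ frob X (G X))
    {X : Matrix ι κ ℝ} (hX : frob X (G X) = 0) : G X = 0 := by
  apply frob_self_eq_zero
  set w := frob (G X) (G X) with hw
  set q := frob (G X) (G (G X)) with hq
  have hq0 : 0 ≤ q := hG' _
  -- The form at X + s G X is 2sw + s²q. The minimizer is −w/q; the denominator q + 1 avoids the
  -- case q = 0 and still gives a negative value for w ≠ 0.
  have h := hG' (X + (-w / (q + 1)) • G X)
  have h1 : frob X (G (G X)) = w := hG _ _
  simp only [map_add, map_smul, LinearMap.add_apply, LinearMap.smul_apply, smul_eq_mul, hX, h1,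
    ← hw, ← hq] at h
  have h2 : 0 + -w / (q + 1) * w + (-w / (q + 1)) * (w + -w / (q + 1) * q) =
      -(w ^ 2 * (q + 2) / (q + 1) ^ 2) := by
    field_simp; ring
  have h3 : w ^ 2 * (q + 2) / (q + 1) ^ 2 ≤ 0 := by
    have : 0 ≤ -(w ^ 2 * (q + 2) / (q + 1) ^ 2) := by
      rw [← h2]; linarith
    linarith
  by_contra hw0
  have : 0 < w ^ 2 * (q + 2) / (q + 1) ^ 2 := by positivity
  linarith

theorem continuous_frob_map (L : Matrix ι κ ℝ →ₗ[ℝ] Matrix ι κ ℝ) :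
    Continuous fun X => frob X (L X) := by
  have hL : Continuous L := L.continuous_of_finiteDimensional
  simp only [frob_apply]
  fun_prop

open scoped Matrix.Norms.Elementwise in
/-- The maximum of the Rayleigh quotient of two self-adjoint operators is a generalized
eigenvalue. -/
theorem exists_generalized_eigenvalue {L P : Matrix ι κ ℝ →ₗ[ℝ] Matrix ι κ ℝ}
    (hL : ∀ X Y, frob X (L Y) = frob (L X) Y) (hP : ∀ X Y, frob X (P Y) = frob (P X) Y)
    (hL' : ∀ X, X ≠ 0 → 0 < frob X (L X)) {Y : Matrix ι κ ℝ} (hY : Y ≠ 0)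
    (hYP : frob Y (L Y) ≤ frob Y (P Y)) :
    ∃ c : ℝ, 1 ≤ c ∧ ∃ X, X ≠ 0 ∧ P X = c • L X := by
  have hLc : Continuous fun X => frob X (L X) := continuous_frob_map L
  have hPc : Continuous fun X => frob X (P X) := continuous_frob_map P
  have hmem : ∀ X : Matrix ι κ ℝ, X ≠ 0 → ‖X‖⁻¹ • X ∈ Metric.sphere (0 : Matrix ι κ ℝ) 1 :=
    fun X hX => by simp [norm_smul, norm_ne_zero_iff.2 hX]
  have hne : ∀ X ∈ Metric.sphere (0 : Matrix ι κ ℝ) 1, X ≠ 0 := by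
    rintro X hX rfl; simp at hX
  obtain ⟨X, hX, hmax⟩ := (isCompact_sphere (0 : Matrix ι κ ℝ) 1).exists_isMaxOn
    ⟨_, hmem Y hY⟩ (f := fun X => frob X (P X) / frob X (L X))
    (hPc.continuousOn.div hLc.continuousOn fun X hX => (hL' X (hne X hX)).ne')
  set c := frob X (P X) / frob X (L X) with hc
  have hmax' : ∀ Z, Z ≠ 0 → frob Z (P Z) / frob Z (L Z) ≤ c := fun Z hZ => by
    have h := hmax (hmem Z hZ)
    have hn : ‖Z‖ ≠ 0 := norm_ne_zero_iff.2 hZ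
    simp only [Set.mem_ofPred_eq, map_smul, LinearMap.smul_apply, smul_eq_mul] at h
    rwa [mul_div_mul_left _ _ (inv_ne_zero hn), mul_div_mul_left _ _ (inv_ne_zero hn)] at h
  have hX0 := hne X hX
  refine ⟨c, ((one_le_div (hL' Y hY)).2 hYP).trans (hmax' Y hY), X, hX0, ?_⟩
  -- Maximality of c makes c L − P semidefinite, and X is isotropic for it.
  have h := eq_zero_of_frob_map_self_eq_zero (G := c • L - P) (X := X)
    (fun X Y => by simp [hL, hP]) (fun Z => by
      rcases eq_or_ne Z 0 with rfl | hZ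
      · simp
      · have := (div_le_iff₀ (hL' Z hZ)).1 (hmax' Z hZ)
        simpa using this)
    (by simp [hc, div_mul_cancel₀ _ (hL' X hX0).ne'])
  exact (sub_eq_zero.1 h).symm

end Matrix

theorem frob_neg_lyapunovOp_pos {ι : Type*} [Fintype ι] {A : Matrix ι ι ℝ} (hA : (-A).PosDef)
    {X : Matrix ι ι ℝ} (hX : X ≠ 0) : 0 < frob X ((-lyapunovOp A) X) := by
  have h1 := hA.frob_mul_left_pos hX
  have h2 := hA.frob_mul_left_pos (X := X.transpose) (by simpa using hX)
  rw [← frob_transpose, transpose_mul, transpose_transpose,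
    transpose_neg, Matrix.mul_neg, map_neg] at h2
  rw [Matrix.neg_mul, map_neg] at h1
  have h : (-lyapunovOp A) X = -(A * X + X * A.transpose) := rfl
  rw [h, map_neg, map_add]
  linarith

theorem lyapunovOp_injective {ι : Type*} [Fintype ι] {A : Matrix ι ι ℝ} (hA : (-A).PosDef) :
    Function.Injective (lyapunovOp A) :=
  (injective_iff_map_eq_zero _).2 fun X hX => by
    by_contra h0
    simpa [hX] using frob_neg_lyapunovOp_pos hA h0

theorem lyapunovOp_surjective {ι : Type*} [Fintype ι] {A : Matrix ι ι ℝ} (hA : (-A).PosDef) :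
    Function.Surjective (lyapunovOp A) :=
  LinearMap.injective_iff_surjective.1 (lyapunovOp_injective hA)

theorem le_realSpectralRadius_of_eigenvector {E : Type*} [AddCommGroup E] [Module ℝ E]
    {T : Module.End ℝ E} {c : ℝ} {x : E} (hx : x ≠ 0) (h : T x = c • x) :
    (‖c‖₊ : ℝ≥0∞) ≤ realSpectralRadius T := by
  have hv : Module.End.HasEigenvector (T.baseChange ℂ) (c : ℂ) ((1 : ℂ) ⊗ₜ[ℝ] x) := by
    refine Module.End.hasEigenvector_iff.2 ⟨Module.End.mem_eigenspace_iff.2 ?_, ?_⟩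
    · rw [LinearMap.baseChange_tmul, h, TensorProduct.tmul_smul, TensorProduct.smul_tmul',
        TensorProduct.smul_tmul']
      simp
    · rwa [Ne, Module.FaithfullyFlat.one_tmul_eq_zero_iff]
  have hs := (Module.End.hasEigenvalue_of_hasEigenvector hv).mem_spectrum
  refine le_trans ?_ (le_iSup₂ (f := fun (k : ℂ) (_ : k ∈ spectrum ℂ (T.baseChange ℂ)) =>
    (‖k‖₊ : ℝ≥0∞)) (c : ℂ) hs)
  simp

namespace BilinearSystem

variable {ι μ ρ : Type*} [Fintype ι] [Fintype μ]

/-- If M were not definite, the largest Rayleigh quotient of the correction against −L would be some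
c ≥ 1. It is attained at an eigenvector, which gives the eigenvalue −c of L⁻¹Π. -/
theorem positive_of_realSpectralRadius_lt_one {S : BilinearSystem ι μ ρ} (hS : S.IsSymmetric)
    (hA : (-S.A).PosDef)
    (hρ : realSpectralRadius (Ring.inverse (lyapunovOp S.A) * correctionOp S.N) < 1) :
    S.Positive S := by
  set L := lyapunovOp S.A with hLdef
  set P := correctionOp S.N with hPdef
  have hLX : ∀ X, L X = S.A * X + X * S.A.transpose := fun X => rfl
  have hPX : ∀ X, P X = ∑ i, S.N i * X * (S.N i).transpose := fun X => rfl
  have hL : ∀ X Y, frob X ((-L) Y) = frob ((-L) X) Y := fun X Y => by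
    simp only [LinearMap.neg_apply, hLX, map_neg, map_add, LinearMap.add_apply]
    rw [frob_mul_left, frob_mul_right, transpose_transpose, hS.A_symm.eq]
  have hP : ∀ X Y, frob X (P Y) = frob (P X) Y := fun X Y => by
    simp only [hPX, map_sum, LinearMap.sum_apply]
    refine Finset.sum_congr rfl fun i _ => ?_
    rw [frob_mul_right, frob_mul_left, (hS.N_symm i).eq, (hS.N_symm i).eq, Matrix.mul_assoc]
  have hL' : ∀ X, X ≠ 0 → 0 < frob X ((-L) X) := fun X hX => frob_neg_lyapunovOp_pos hA hX
  have hinj : Function.Injective L := lyapunovOp_injective hA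
  have hu : IsUnit L := (Module.End.isUnit_iff L).2
    ⟨hinj, lyapunovOp_surjective hA⟩
  by_contra hpos
  simp only [Positive, not_forall, not_lt] at hpos
  obtain ⟨Y, hY, hYle⟩ := hpos
  have hsyl : S.sylvesterOp S Y = (-L) Y - P Y := by
    rw [sylvesterOp_apply, LinearMap.neg_apply, hLX, hPX]; abel
  rw [hsyl, map_sub, sub_nonpos] at hYle
  obtain ⟨c, hc, X, hX, hPc⟩ := exists_generalized_eigenvalue hL hP hL' hY hYle
  have hev : (Ring.inverse L * P) X = (-c) • X := by
    rw [Module.End.mul_apply, hPc, LinearMap.neg_apply, smul_neg, ← neg_smul, map_smul,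
      ← Module.End.mul_apply, Ring.inverse_mul_cancel L hu, Module.End.one_apply]
  have h := (le_realSpectralRadius_of_eigenvector hX hev).trans_lt hρ
  rw [nnnorm_neg] at h
  have h' : ‖c‖₊ < 1 := by exact_mod_cast h
  have h'' : ‖c‖ < 1 := by exact_mod_cast h'
  rw [Real.norm_of_nonneg (by linarith)] at h''
  linarith

end BilinearSystem

open Filter

/-! ### The H₂-norm as a pairing with the Gramian. -/

section Gramian

open MeasureTheory Set

namespace Matrix

variable {ι : Type*} [Fintype ι]

theorem frob_vecMulVec {κ : Type*} [Fintype κ] (x : ι → ℝ) (y : κ → ℝ) (Q : Matrix ι κ ℝ) :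
    frob (vecMulVec x y) Q = x ⬝ᵥ Q *ᵥ y := by
  rw [frob_apply, transpose_vecMulVec, vecMulVec_mul, trace_vecMulVec, dotProduct_comm,
    dotProduct_mulVec]

theorem PosSemidef.vecMulVec_self (x : ι → ℝ) : (vecMulVec x x).PosSemidef := by
  simpa using posSemidef_vecMulVec_self_star x

theorem posSemidef_of_frob_nonneg {Q : Matrix ι ι ℝ} (hQ : Q.IsSymm)
    (h : ∀ R : Matrix ι ι ℝ, R.PosSemidef → 0 ≤ frob R Q) : Q.PosSemidef :=
  PosSemidef.of_dotProduct_mulVec_nonneg (by simpa [IsHermitian] using hQ.eq) fun x => by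
    simpa [frob_vecMulVec] using h _ (PosSemidef.vecMulVec_self x)

theorem PosSemidef.mul_mul_of_isSymm {R E : Matrix ι ι ℝ} (hR : R.PosSemidef) (hE : E.IsSymm) :
    (E * R * E).PosSemidef := by
  have := hR.mul_mul_conjTranspose_same E
  rwa [conjTranspose_eq_transpose_of_trivial, hE.eq] at this

theorem posSemidef_mul_transpose {κ : Type*} [Fintype κ] (B : Matrix ι κ ℝ) :
    (B * B.transpose).PosSemidef := by
  simpa using posSemidef_self_mul_conjTranspose B

theorem frob_conj_of_isSymm {E : Matrix ι ι ℝ} (hE : E.IsSymm) (R Q : Matrix ι ι ℝ) :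
    frob R (E * Q * E) = frob (E * R * E) Q := by
  rw [frob_mul_right, frob_mul_left, hE.eq, Matrix.mul_assoc]

variable [DecidableEq ι]

theorem tendsto_exp_smul_of_posDef_neg {A : Matrix ι ι ℝ} (hA : (-A).PosDef) :
    Tendsto (fun s : ℝ => NormedSpace.exp (s • A)) atTop (𝓝 0) := by
  set U := Unitary.toUnits hA.1.eigenvectorUnitary
  set d := hA.1.eigenvalues with hd
  have hspec : ∀ s : ℝ, s • A =
      (U : Matrix ι ι ℝ) * diagonal (fun i => -(s * d i)) * ((U⁻¹ : (Matrix ι ι ℝ)ˣ) : Matrix ι ι ℝ) :=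
    fun s => by
      have h := hA.1.spectral_theorem
      rw [Unitary.conjStarAlgAut_apply] at h
      have h2 : (diagonal fun i => -(s * d i) : Matrix ι ι ℝ) =
          (-s) • diagonal (RCLike.ofReal ∘ hA.1.eigenvalues) := by
        rw [← diagonal_smul]; congr 1; ext i; simp [hd]
      rw [h2, Matrix.mul_smul, Matrix.smul_mul, neg_smul, ← smul_neg]
      congr 1
      rw [eq_comm, neg_eq_iff_eq_neg, eq_comm, eq_comm]
      exact h.symm
  have hexp : ∀ s : ℝ, NormedSpace.exp (s • A) = (U : Matrix ι ι ℝ) *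
      diagonal (fun i => Real.exp (-(s * d i))) * ((U⁻¹ : (Matrix ι ι ℝ)ˣ) : Matrix ι ι ℝ) :=
    fun s => by
      rw [hspec, Matrix.exp_units_conj, Matrix.exp_diagonal]
      congr 3
      ext i
      rw [Pi.coe_exp, Real.exp_eq_exp_ℝ]
  have h0 : Tendsto (fun s : ℝ => (diagonal (fun i => Real.exp (-(s * d i))) : Matrix ι ι ℝ))
      atTop (𝓝 (diagonal 0)) := by
    refine ((continuous_id.matrix_diagonal).tendsto (0 : ι → ℝ)).comp
      (tendsto_pi_nhds.2 fun i => ?_)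
    exact Real.tendsto_exp_neg_atTop_nhds_zero.comp
      (tendsto_id.atTop_mul_const (hA.eigenvalues_pos i))
  simp only [hexp]
  have := (tendsto_const_nhds (x := (U : Matrix ι ι ℝ))).mul h0
  have := this.mul (tendsto_const_nhds (x := ((U⁻¹ : (Matrix ι ι ℝ)ˣ) : Matrix ι ι ℝ)))
  simpa using this

open scoped Matrix.Norms.Operator in
theorem continuous_exp_smul (A : Matrix ι ι ℝ) :
    Continuous fun s : ℝ => NormedSpace.exp (s • A) :=
  NormedSpace.exp_continuous.comp (continuous_id.smul continuous_const)

open scoped Matrix.Norms.Operator in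
theorem hasDerivAt_frob_exp (A Q R : Matrix ι ι ℝ) (s : ℝ) :
    HasDerivAt (fun s : ℝ => frob R (NormedSpace.exp (s • A) * Q * NormedSpace.exp (s • A)))
      (frob R (NormedSpace.exp (s • A) * (A * Q + Q * A) * NormedSpace.exp (s • A))) s := by
  have h := ((hasDerivAt_exp_smul_const A s).mul_const Q).mul (hasDerivAt_exp_smul_const' A s)
  have h2 := (LinearMap.toContinuousLinearMap (frob R)).hasFDerivAt.comp_hasDerivAt s h
  refine h2.congr_deriv (congrArg (frob R) ?_)
  simp only [Matrix.mul_add, Matrix.add_mul, Matrix.mul_assoc]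
  rfl

/-- The integrand is nonnegative with antiderivative −⟨R, e^{sA} Q e^{sA}⟩, which tends to 0 at
infinity. The sign of ⟨R, Q⟩ is what later makes Lyapunov solutions semidefinite. -/
theorem lintegral_frob_exp {A Q F R : Matrix ι ι ℝ} (hA : A.IsSymm) (hA' : (-A).PosDef)
    (hR : R.PosSemidef) (hF : F.PosSemidef) (hQ : A * Q + Q * A = -F) :
    0 ≤ frob R Q ∧ ∫⁻ s in Ici (0 : ℝ), ENNReal.ofReal
      (frob R (NormedSpace.exp (s • A) * F * NormedSpace.exp (s • A))) =
        ENNReal.ofReal (frob R Q) := by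
  set g : ℝ → ℝ := fun s => -frob R (NormedSpace.exp (s • A) * Q * NormedSpace.exp (s • A))
  set g' : ℝ → ℝ := fun s => frob R (NormedSpace.exp (s • A) * F * NormedSpace.exp (s • A))
    with hg'
  have hder : ∀ s ∈ Ici (0 : ℝ), HasDerivAt g (g' s) s := fun s _ => by
    have h := (hasDerivAt_frob_exp A Q R s).neg
    rw [hQ] at h
    rw [Matrix.mul_neg, Matrix.neg_mul, map_neg, neg_neg] at h
    exact h
  have hnn : ∀ s, 0 ≤ g' s := fun s =>
    frob_nonneg hR (hF.mul_mul_of_isSymm (IsSymm.exp (hA.smul s)))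
  have hlim : Tendsto g atTop (𝓝 0) := by
    have h := tendsto_exp_smul_of_posDef_neg hA'
    have h2 : Continuous fun E : Matrix ι ι ℝ => -frob R (E * Q * E) := by
      simp only [frob_apply]; fun_prop
    have h3 := (h2.tendsto 0).comp h
    simpa [g, Function.comp_def] using h3
  have hint := integral_Ioi_of_hasDerivAt_of_nonneg' hder (fun s _ => hnn s) hlim
  have hio := integrableOn_Ioi_deriv_of_nonneg' hder (fun s _ => hnn s) hlim
  have hg0 : 0 - g 0 = frob R Q := by simp [g]
  rw [hg0] at hint
  refine ⟨hint ▸ integral_nonneg hnn, ?_⟩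
  rw [← hint, ofReal_integral_eq_lintegral_ofReal hio (ae_of_all _ hnn)]
  exact setLIntegral_congr Ioi_ae_eq_Ici.symm

end Matrix

/-- Tonelli, splitting off the last time, the one in the outermost exponential of the kernel. -/
theorem lintegral_nonneg_orthant_succ {j : ℕ} {G : ℝ × (Fin j → ℝ) → ℝ≥0∞} (hG : Measurable G) :
    ∫⁻ s in {s : Fin (j + 1) → ℝ | ∀ i, 0 ≤ s i}, G (s (Fin.last j), Fin.init s) =
      ∫⁻ t in Ici 0, ∫⁻ s in {s : Fin j → ℝ | ∀ i, 0 ≤ s i}, G (t, s) := by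
  set e := MeasurableEquiv.piFinSuccAbove (fun _ : Fin (j + 1) => ℝ) (Fin.last j) with hedef
  have he : ∀ s, e s = (s (Fin.last j), Fin.init s) := fun s => by
    rw [← Fin.removeNth_last]; rfl
  have hset : {s : Fin (j + 1) → ℝ | ∀ i, 0 ≤ s i} =
      e ⁻¹' (Ici 0 ×ˢ {s : Fin j → ℝ | ∀ i, 0 ≤ s i}) := by
    ext s
    rw [mem_preimage, he]
    simp [Fin.forall_fin_succ', and_comm, Fin.init]
  have hprod : (volume : Measure (ℝ × (Fin j → ℝ))) = volume.prod volume := rfl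
  rw [← setLIntegral_prod _ hG.aemeasurable, ← hprod, hset,
    ← (volume_preserving_piFinSuccAbove (fun _ : Fin (j + 1) => ℝ)
      (Fin.last j)).setLIntegral_comp_preimage_emb e.measurableEmbedding]
  simp only [← he]
  rfl

namespace BilinearSystem

variable {ι μ ρ : Type*} [Fintype ι] [DecidableEq ι] [Fintype μ] [Fintype ρ]

omit [Fintype μ] [Fintype ρ] in
theorem continuous_stateKernel (S : BilinearSystem ι μ ρ) :
    ∀ (j : ℕ) (l : Fin j → μ), Continuous (S.stateKernel j l)
  | 0, _ => ((continuous_exp_smul S.A).comp (continuous_apply 0)).matrix_mul continuous_const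
  | j + 1, l => ((((continuous_exp_smul S.A).comp (continuous_apply (Fin.last (j + 1)))).matrix_mul
      continuous_const).matrix_mul ((continuous_stateKernel S j (Fin.tail l)).comp
        (continuous_pi fun i => continuous_apply (Fin.castSucc i))))

omit [DecidableEq ι] [Fintype ρ] in
theorem posSemidef_correctionOp {S : BilinearSystem ι μ ρ} {Q : Matrix ι ι ℝ}
    (hQ : Q.PosSemidef) : (correctionOp S.N Q).PosSemidef :=
  posSemidef_sum _ fun i _ => by simpa using hQ.mul_mul_conjTranspose_same (S.N i)

/-- The weight that the outermost factor of a kernel turns a weight `R` into. -/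
noncomputable def kernelWeight (S : BilinearSystem ι μ ρ) (R : Matrix ι ι ℝ) (t : ℝ) :
    Matrix ι ι ℝ :=
  ∑ i, S.N i * (NormedSpace.exp (t • S.A) * R * NormedSpace.exp (t • S.A)) * S.N i

omit [Fintype ρ] in
theorem frob_kernelWeight {S : BilinearSystem ι μ ρ} (hS : S.IsSymmetric)
    (R K : Matrix ι ι ℝ) (t : ℝ) :
    frob (S.kernelWeight R t) K = frob R
      (NormedSpace.exp (t • S.A) * correctionOp S.N K * NormedSpace.exp (t • S.A)) := by
  have hc : correctionOp S.N K = ∑ i, S.N i * K * S.N i :=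
    Finset.sum_congr rfl fun i _ => by rw [(hS.N_symm i).eq]
  rw [frob_conj_of_isSymm (IsSymm.exp (hS.A_symm.smul t)), hc, kernelWeight, map_sum, map_sum,
    LinearMap.sum_apply]
  exact Finset.sum_congr rfl fun i _ => (frob_conj_of_isSymm (hS.N_symm i) _ _).symm

omit [Fintype ρ] in
theorem posSemidef_kernelWeight {S : BilinearSystem ι μ ρ} (hS : S.IsSymmetric)
    {R : Matrix ι ι ℝ} (hR : R.PosSemidef) (t : ℝ) : (S.kernelWeight R t).PosSemidef :=
  posSemidef_sum _ fun i _ =>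
    (hR.mul_mul_of_isSymm (IsSymm.exp (hS.A_symm.smul t))).mul_mul_of_isSymm (hS.N_symm i)

omit [Fintype ρ] in
theorem continuous_kernelWeight (S : BilinearSystem ι μ ρ) (R : Matrix ι ι ℝ) :
    Continuous (S.kernelWeight R) := by
  have := continuous_exp_smul S.A
  refine continuous_finsetSum _ fun i _ => ?_
  fun_prop

theorem sum_frob_stateKernel_succ {S : BilinearSystem ι μ ρ} (hS : S.IsSymmetric)
    (R : Matrix ι ι ℝ) (j : ℕ) (s : Fin (j + 2) → ℝ) :
    ∑ l, frob R (S.stateKernel (j + 1) l s * (S.stateKernel (j + 1) l s).transpose) =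
      ∑ l, frob (S.kernelWeight R (s (Fin.last (j + 1))))
        (S.stateKernel j l (Fin.init s) * (S.stateKernel j l (Fin.init s)).transpose) := by
  rw [← (Fin.consEquiv fun _ : Fin (j + 1) => μ).sum_comp, Fintype.sum_prod_type,
    Finset.sum_comm]
  refine Finset.sum_congr rfl fun l _ => ?_
  rw [frob_kernelWeight hS]
  simp only [correctionOp, LinearMap.coe_mk, AddHom.coe_mk, Finset.mul_sum, Finset.sum_mul,
    map_sum]
  refine Finset.sum_congr rfl fun i _ => ?_
  have hk : S.stateKernel (j + 1) ((Fin.consEquiv fun _ : Fin (j + 1) => μ) (i, l)) s =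
      NormedSpace.exp (s (Fin.last (j + 1)) • S.A) * S.N i * S.stateKernel j l (Fin.init s) := rfl
  rw [hk, transpose_mul, transpose_mul,
    (IsSymm.exp (hS.A_symm.smul (s (Fin.last (j + 1))))).eq]
  simp only [Matrix.mul_assoc]

/-- The integrals of the Volterra series are the iterates of the Lyapunov equation. -/
theorem lintegral_stateKernel {S : BilinearSystem ι μ ρ} (hS : S.IsSymmetric)
    (hA : (-S.A).PosDef) {Q : ℕ → Matrix ι ι ℝ} (hQpos : ∀ j, (Q j).PosSemidef)
    (hQ0 : S.A * Q 0 + Q 0 * S.A = -(S.B * S.B.transpose))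
    (hQ : ∀ j, S.A * Q (j + 1) + Q (j + 1) * S.A = -correctionOp S.N (Q j)) :
    ∀ (j : ℕ) {R : Matrix ι ι ℝ}, R.PosSemidef →
      ∫⁻ s in {s : Fin (j + 1) → ℝ | ∀ i, 0 ≤ s i}, ENNReal.ofReal
        (∑ l, frob R (S.stateKernel j l s * (S.stateKernel j l s).transpose)) =
          ENNReal.ofReal (frob R (Q j)) := by
  -- The weight R stays general: the induction step moves the outermost kernel factor into it.
  intro j
  induction j with
  | zero =>
    intro R hR
    rw [← (lintegral_frob_exp hS.A_symm hA hR (posSemidef_mul_transpose S.B) hQ0).2]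
    have h := (volume_preserving_funUnique (Fin 1) ℝ).setLIntegral_comp_preimage_emb
      (MeasurableEquiv.measurableEmbedding _) (fun s => ENNReal.ofReal
        (frob R (NormedSpace.exp (s • S.A) * (S.B * S.B.transpose) * NormedSpace.exp (s • S.A))))
      (Ici 0)
    rw [← h]
    have hset : {s : Fin 1 → ℝ | ∀ i, 0 ≤ s i} =
        (MeasurableEquiv.funUnique (Fin 1) ℝ) ⁻¹' Ici 0 := by
      ext s; simp [MeasurableEquiv.funUnique]
    rw [hset]
    refine lintegral_congr fun s => ?_
    have he : (NormedSpace.exp (s 0 • S.A)).IsSymm := IsSymm.exp (hS.A_symm.smul (s 0))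
    simp [stateKernel, transpose_mul, he.eq, Matrix.mul_assoc, MeasurableEquiv.funUnique]
  | succ j ih =>
    intro R hR
    have hpc : (correctionOp S.N (Q j)).PosSemidef := posSemidef_correctionOp (hQpos j)
    rw [← (lintegral_frob_exp hS.A_symm hA hR hpc (hQ j)).2]
    have hGm : Measurable fun p : ℝ × (Fin (j + 1) → ℝ) => ENNReal.ofReal
        (∑ l, frob (S.kernelWeight R p.1)
          (S.stateKernel j l p.2 * (S.stateKernel j l p.2).transpose)) := by
      have h1 := S.continuous_kernelWeight R
      have h2 := S.continuous_stateKernel j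
      simp only [frob_apply]
      refine (ENNReal.continuous_ofReal.comp (continuous_finsetSum _ fun l _ => ?_)).measurable
      have h3 := h2 l
      fun_prop
    rw [lintegral_congr fun s => congrArg ENNReal.ofReal (sum_frob_stateKernel_succ hS R j s),
      lintegral_nonneg_orthant_succ hGm]
    refine lintegral_congr fun t => ?_
    rw [← frob_kernelWeight hS]
    have h := ih (posSemidef_kernelWeight hS hR t)
    simp only
    rw [h]

end BilinearSystem

namespace Matrix

variable {ι : Type*} [Fintype ι]

/-- A sequence of symmetric matrices tends to zero if its quadratic forms do. -/
theorem tendsto_zero_of_frob {Q : ℕ → Matrix ι ι ℝ} (hQ : ∀ j, (Q j).IsSymm)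
    (h : ∀ R : Matrix ι ι ℝ, R.PosSemidef → Tendsto (fun j => frob R (Q j)) atTop (𝓝 0)) :
    Tendsto Q atTop (𝓝 0) := by
  classical
  have hx : ∀ x : ι → ℝ, Tendsto (fun j => x ⬝ᵥ Q j *ᵥ x) atTop (𝓝 0) := fun x => by
    simpa only [frob_vecMulVec] using h _ (PosSemidef.vecMulVec_self x)
  refine tendsto_pi_nhds.2 fun a => tendsto_pi_nhds.2 fun b => ?_
  -- Polarization recovers the entry (a, b).
  have h1 := ((hx (Pi.single a 1 + Pi.single b 1)).sub
    ((hx (Pi.single a 1)).add (hx (Pi.single b 1)))).div_const 2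
  simp only [add_zero, sub_zero, zero_div] at h1
  refine h1.congr fun j => ?_
  have hab : Q j b a = Q j a b := (hQ j).apply a b
  simp only [mulVec_add, dotProduct_add, add_dotProduct, mulVec_single_one,
    single_one_dotProduct, col_apply, hab]
  ring

end Matrix

namespace BilinearSystem

variable {ι μ ρ : Type*} [Fintype ι] [DecidableEq ι] [Fintype μ] [Fintype ρ]

/-- The iterates of the Lyapunov equation that sum up to the Gramian. -/
theorem exists_gramian_iterates {S : BilinearSystem ι μ ρ} (hS : S.IsSymmetric)
    (hA : (-S.A).PosDef) : ∃ Q : ℕ → Matrix ι ι ℝ, (∀ j, (Q j).PosSemidef) ∧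
      S.A * Q 0 + Q 0 * S.A = -(S.B * S.B.transpose) ∧
      ∀ j, S.A * Q (j + 1) + Q (j + 1) * S.A = -correctionOp S.N (Q j) := by
  have hL : ∀ X, lyapunovOp S.A X = S.A * X + X * S.A := fun X => by
    have h : lyapunovOp S.A X = S.A * X + X * S.A.transpose := rfl
    rw [h, hS.A_symm.eq]
  choose f hf using lyapunovOp_surjective hA
  have hpos : ∀ F : Matrix ι ι ℝ, F.PosSemidef → (f (-F)).PosSemidef := fun F hF => by
    have hsymm : (f (-F)).IsSymm := by
      apply lyapunovOp_injective hA
      have h := congrArg transpose (hf (-F))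
      have hF' : F.transpose = F := by simpa using hF.1.eq
      rw [hL, transpose_add, transpose_mul, transpose_mul, hS.A_symm.eq, transpose_neg, hF',
        add_comm] at h
      rw [hL, h, hf]
    exact posSemidef_of_frob_nonneg hsymm fun R hR =>
      (lintegral_frob_exp hS.A_symm hA hR hF ((hL _).symm.trans (hf _))).1
  set Q : ℕ → Matrix ι ι ℝ := fun j => Nat.rec (f (-(S.B * S.B.transpose)))
    (fun _ q => f (-correctionOp S.N q)) j
  have hQ0 : Q 0 = f (-(S.B * S.B.transpose)) := rfl
  have hQs : ∀ j, Q (j + 1) = f (-correctionOp S.N (Q j)) := fun _ => rfl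
  refine ⟨Q, fun j => ?_, ?_, fun j => ?_⟩
  · induction j with
    | zero => exact hpos _ (posSemidef_mul_transpose S.B)
    | succ j ih => exact hpos _ (posSemidef_correctionOp ih)
  · rw [← hL, hQ0, hf]
  · rw [← hL, hQs, hf]

/-- The squared `H₂`-norm in terms of the Gramian. -/
theorem h2NormSq_eq {S : BilinearSystem ι μ ρ} (hS : S.IsSymmetric) (hpos : S.Positive S)
    {P : Matrix ι ι ℝ} (hP : S.sylvesterOp S P = S.B * S.B.transpose) :
    P.PosSemidef ∧ S.h2NormSq = ENNReal.ofReal (frob (S.C.transpose * S.C) P) := by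
  have hA := hpos.posDef_neg_A hS
  obtain ⟨Q, hQpos, hQ0, hQ⟩ := exists_gramian_iterates hS hA
  set F := S.B * S.B.transpose with hF
  have hFpos : F.PosSemidef := posSemidef_mul_transpose S.B
  set p : ℕ → Matrix ι ι ℝ := fun J => ∑ j ∈ Finset.range J, Q j with hp
  have hp_pos : ∀ J, (p J).PosSemidef := fun J => posSemidef_sum _ fun j _ => hQpos j
  -- The sum telescopes: the defect of a partial sum is a single correction term.
  have hMp : ∀ J, S.sylvesterOp S (p (J + 1)) = F - correctionOp S.N (Q J) := by
    have hM : ∀ X, S.sylvesterOp S X = -(S.A * X + X * S.A) - correctionOp S.N X := fun X => by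
      rw [sylvesterOp_apply, hS.A_symm.eq, neg_add]; rfl
    intro J
    induction J with
    | zero => simp [hp, hM, hQ0]
    | succ J ih =>
      have h : p (J + 1 + 1) = p (J + 1) + Q (J + 1) := Finset.sum_range_succ _ _
      rw [h, map_add, ih, hM, hQ]
      abel
  -- The defect has the sign that gives ⟨p, M p⟩ ≤ ⟨p, F⟩; with 2⟨p, F⟩ − ⟨p, M p⟩ ≤ ⟨P, F⟩ this
  -- bounds the energies. Convergence of the series thus needs only definiteness.
  have hle : ∀ J, frob (p (J + 1)) (S.sylvesterOp S (p (J + 1))) ≤ frob P F := fun J => by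
    have h1 : 0 ≤ frob (p (J + 1)) (correctionOp S.N (Q J)) :=
      frob_nonneg (hp_pos _) (posSemidef_correctionOp (hQpos J))
    have h2 := hpos.two_mul_sub_le hS hS hP (p (J + 1))
    have h3 : frob (p (J + 1)) (S.sylvesterOp S (p (J + 1))) ≤ frob (p (J + 1)) F := by
      rw [hMp, map_sub]; linarith
    linarith
  have hsum : ∀ R : Matrix ι ι ℝ, R.PosSemidef → Summable fun j => frob R (Q j) := fun R hR => by
    obtain ⟨Z, hZ⟩ := hpos.surjective R
    refine summable_of_sum_range_le (c := frob Z R + frob P F)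
      (fun j => frob_nonneg hR (hQpos j)) fun J => ?_
    have h0 : ∑ j ∈ Finset.range J, frob R (Q j) ≤ frob R (p (J + 1)) := by
      rw [hp, map_sum, Finset.sum_range_succ]
      exact le_add_of_nonneg_right (frob_nonneg hR (hQpos J))
    have h1 := hpos.two_mul_sub_le hS hS hZ (p (J + 1))
    have h2 := hle J
    have h3 := frob_nonneg hR (hp_pos (J + 1))
    rw [frob_comm _ R] at h1
    linarith
  have hQlim : Tendsto Q atTop (𝓝 0) := tendsto_zero_of_frob
    (fun j => by simpa [IsHermitian, IsSymm] using (hQpos j).1)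
    fun R hR => (hsum R hR).tendsto_atTop_zero
  -- With M Z = R, the error ⟨R, P − p⟩ is ⟨Z, M (P − p)⟩, the pairing of Z with the vanishing
  -- defect.
  have hplim : ∀ R, Tendsto (fun J => frob R (p (J + 1))) atTop (𝓝 (frob R P)) := fun R => by
    obtain ⟨Z, hZ⟩ := hpos.surjective R
    have hc : Continuous fun K : Matrix ι ι ℝ => frob Z (correctionOp S.N K) := by
      simp only [frob_apply, correctionOp, LinearMap.coe_mk, AddHom.coe_mk]; fun_prop
    have h := ((hc.tendsto 0).comp hQlim).const_sub (frob R P)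
    simp only [map_zero, sub_zero] at h
    refine h.congr fun J => ?_
    have h1 : frob R (P - p (J + 1)) = frob Z (correctionOp S.N (Q J)) := by
      rw [← hZ, ← frob_sylvesterOp_comm hS hS, map_sub, hP, hMp, sub_sub_cancel]
    rw [Function.comp_apply, ← h1, map_sub, sub_sub_cancel]
  refine ⟨posSemidef_of_frob_nonneg
    (hpos.isSymm_of_solves (by simpa [IsHermitian, IsSymm] using hFpos.1) hP) fun R hR =>
      ge_of_tendsto' (hplim R) fun J => frob_nonneg hR (hp_pos _), ?_⟩
  have hR : (S.C.transpose * S.C).PosSemidef := by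
    simpa using posSemidef_mul_transpose S.C.transpose
  have hHas : HasSum (fun j => frob (S.C.transpose * S.C) (Q j))
      (frob (S.C.transpose * S.C) P) := by
    rw [(hsum _ hR).hasSum_iff_tendsto_nat, ← tendsto_add_atTop_iff_nat 1]
    refine (hplim _).congr fun J => ?_
    rw [hp, map_sum]
  rw [← hHas.tsum_eq, ENNReal.ofReal_tsum_of_nonneg (fun j => frob_nonneg hR (hQpos j))
    (hsum _ hR), h2NormSq]
  refine tsum_congr fun j => ?_
  rw [← lintegral_stateKernel hS hA hQpos hQ0 hQ j hR]
  refine lintegral_congr fun s => congrArg ENNReal.ofReal (Finset.sum_congr rfl fun l _ => ?_)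
  rw [volterraKernel, frob_apply, transpose_mul, transpose_mul, transpose_transpose,
    ← Matrix.mul_assoc, Matrix.trace_mul_comm, ← Matrix.mul_assoc, ← Matrix.mul_assoc]
  simp only [Matrix.mul_assoc]

end BilinearSystem

end Gramian

/-! ### Error systems and changes of coordinates. -/

namespace Matrix

variable {ι κ ι' κ' α : Type*}

theorem frob_fromBlocks [Fintype ι] [Fintype κ] [Fintype ι'] [Fintype κ'] (A A' : Matrix ι ι' ℝ)
    (B B' : Matrix ι κ' ℝ) (C C' : Matrix κ ι' ℝ) (D D' : Matrix κ κ' ℝ) :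
    frob (fromBlocks A B C D) (fromBlocks A' B' C' D') =
      frob A A' + frob B B' + frob C C' + frob D D' := by
  simp only [frob_eq_sum, Fintype.sum_sum_type, fromBlocks_apply₁₁, fromBlocks_apply₁₂,
    fromBlocks_apply₂₁, fromBlocks_apply₂₂, Finset.sum_add_distrib]
  ring

theorem sum_fromBlocks (s : Finset α) (A : α → Matrix ι ι' ℝ) (B : α → Matrix ι κ' ℝ)
    (C : α → Matrix κ ι' ℝ) (D : α → Matrix κ κ' ℝ) :
    ∑ a ∈ s, fromBlocks (A a) (B a) (C a) (D a) =
      fromBlocks (∑ a ∈ s, A a) (∑ a ∈ s, B a) (∑ a ∈ s, C a) (∑ a ∈ s, D a) := by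
  ext (i | i) (j | j) <;> simp [sum_apply]

end Matrix

namespace BilinearSystem

variable {ι κ μ ρ : Type*} [Fintype ι] [Fintype κ] [Fintype μ]
  {S : BilinearSystem ι μ ρ} {T : BilinearSystem κ μ ρ}

/-- Block diagonal coefficients do not mix blocks, so the error Gramian is assembled from the full,
cross and reduced Gramians. -/
theorem sylvesterOp_error (X : Matrix ι ι ℝ) (Y : Matrix ι κ ℝ) (Y' : Matrix κ ι ℝ)
    (Z : Matrix κ κ ℝ) : (S.error T).sylvesterOp (S.error T) (fromBlocks X Y Y' Z) =
      fromBlocks (S.sylvesterOp S X) (S.sylvesterOp T Y) (T.sylvesterOp S Y')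
        (T.sylvesterOp T Z) := by
  simp [sylvesterOp_apply, error, fromBlocks_transpose, fromBlocks_multiply, fromBlocks_add,
    fromBlocks_neg, sum_fromBlocks]

omit [Fintype ι] [Fintype κ] [Fintype μ] in
theorem IsSymmetric.error (hS : S.IsSymmetric) (hT : T.IsSymmetric) :
    (S.error T).IsSymmetric where
  A_symm := hS.A_symm.fromBlocks (by simp) hT.A_symm
  N_symm i := (hS.N_symm i).fromBlocks (by simp) (hT.N_symm i)

theorem Positive.error (hSS : S.Positive S) (hST : S.Positive T) (hTT : T.Positive T) :
    (S.error T).Positive (S.error T) := by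
  intro X hX
  rw [← fromBlocks_toBlocks X] at hX ⊢
  rw [sylvesterOp_error, frob_fromBlocks]
  by_contra! hle
  have h1 := hSS.nonneg X.toBlocks₁₁
  have h2 := hST.nonneg X.toBlocks₁₂
  have h3 := hST.symm.nonneg X.toBlocks₂₁
  have h4 := hTT.nonneg X.toBlocks₂₂
  apply hX
  rw [hSS.eq_zero (Y := X.toBlocks₁₁) (by linarith), hST.eq_zero (Y := X.toBlocks₁₂) (by linarith),
    hST.symm.eq_zero (Y := X.toBlocks₂₁) (by linarith),
    hTT.eq_zero (Y := X.toBlocks₂₂) (by linarith), fromBlocks_zero]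

/-- The squared `H₂`-norm of the error of a symmetric system. -/
theorem h2NormSq_error [DecidableEq ι] [DecidableEq κ] [Fintype ρ] (hS : S.IsSymmetric)
    (hT : T.IsSymmetric) (hSS : S.Positive S) (hST : S.Positive T) (hTT : T.Positive T)
    (hSB : S.B = S.C.transpose) (hTB : T.B = T.C.transpose)
    {X : Matrix ι ι ℝ} {Y : Matrix ι κ ℝ} {Z : Matrix κ κ ℝ}
    (hX : S.sylvesterOp S X = S.B * S.B.transpose)
    (hY : S.sylvesterOp T Y = S.B * T.B.transpose)
    (hZ : T.sylvesterOp T Z = T.B * T.B.transpose) :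
    0 ≤ frob X (S.B * S.B.transpose) - 2 * frob Y (S.B * T.B.transpose) +
        frob Z (T.B * T.B.transpose) ∧
      (S.error T).h2NormSq = ENNReal.ofReal (frob X (S.B * S.B.transpose) -
        2 * frob Y (S.B * T.B.transpose) + frob Z (T.B * T.B.transpose)) := by
  have hP : (S.error T).sylvesterOp (S.error T) (fromBlocks X Y Y.transpose Z) =
      (S.error T).B * (S.error T).B.transpose := by
    rw [sylvesterOp_error, ← sylvesterOp_transpose, hX, hY, hZ]
    simp [BilinearSystem.error, transpose_fromRows]
  obtain ⟨hpos, heq⟩ := h2NormSq_eq (hS.error hT) (hSS.error hST hTT) hP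
  -- Since B = Cᵀ, the output weight equals the input weight up to the sign of the off-diagonal
  -- blocks; hence the term −2q.
  have hC : (S.error T).C.transpose * (S.error T).C = fromBlocks (S.B * S.B.transpose)
      (-(S.B * T.B.transpose)) (-(S.B * T.B.transpose).transpose) (T.B * T.B.transpose) := by
    simp [BilinearSystem.error, transpose_fromCols, hSB, hTB]
  have hval : frob ((S.error T).C.transpose * (S.error T).C) (fromBlocks X Y Y.transpose Z) =
      frob X (S.B * S.B.transpose) - 2 * frob Y (S.B * T.B.transpose) +
        frob Z (T.B * T.B.transpose) := by
    rw [hC, frob_fromBlocks, map_neg, map_neg, LinearMap.neg_apply, LinearMap.neg_apply,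
      frob_transpose, frob_comm X, frob_comm Y, frob_comm Z]
    ring
  rw [hval] at heq
  refine ⟨hval ▸ frob_nonneg ?_ hpos, heq⟩
  simpa using posSemidef_mul_transpose (S.error T).C.transpose

/-- The system in the coordinates given by an invertible matrix. -/
noncomputable def conj [DecidableEq ι] (S : BilinearSystem ι μ ρ) (U : (Matrix ι ι ℝ)ˣ) :
    BilinearSystem ι μ ρ where
  A := (U⁻¹ : (Matrix ι ι ℝ)ˣ).val * S.A * U.val
  N i := (U⁻¹ : (Matrix ι ι ℝ)ˣ).val * S.N i * U.val
  B := (U⁻¹ : (Matrix ι ι ℝ)ˣ).val * S.B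
  C := S.C * U.val

omit [Fintype μ] in
theorem stateKernel_conj [DecidableEq ι] (S : BilinearSystem ι μ ρ) (U : (Matrix ι ι ℝ)ˣ) (j : ℕ)
    (l : Fin j → μ) (s : Fin (j + 1) → ℝ) :
    (S.conj U).stateKernel j l s = (U⁻¹ : (Matrix ι ι ℝ)ˣ).val * S.stateKernel j l s := by
  have hexp : ∀ t : ℝ, NormedSpace.exp (t • (S.conj U).A) =
      (U⁻¹ : (Matrix ι ι ℝ)ˣ).val * NormedSpace.exp (t • S.A) * U.val := fun t => by
    rw [← Matrix.exp_units_conj', conj]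
    simp
  have hU : ∀ K : Matrix ι ρ ℝ, U.val * ((U⁻¹ : (Matrix ι ι ℝ)ˣ).val * K) = K := fun K => by
    rw [← Matrix.mul_assoc, Units.mul_inv, Matrix.one_mul]
  have hU' : ∀ K : Matrix ι ι ℝ, U.val * ((U⁻¹ : (Matrix ι ι ℝ)ˣ).val * K) = K := fun K => by
    rw [← Matrix.mul_assoc, Units.mul_inv, Matrix.one_mul]
  induction j with
  | zero =>
    rw [stateKernel, stateKernel, hexp]
    simp only [conj, Matrix.mul_assoc, hU]
  | succ j ih =>
    rw [stateKernel, stateKernel, hexp, ih]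
    simp only [conj, Matrix.mul_assoc, hU, hU']

theorem h2NormSq_conj [DecidableEq ι] [Fintype ρ] (S : BilinearSystem ι μ ρ)
    (U : (Matrix ι ι ℝ)ˣ) : (S.conj U).h2NormSq = S.h2NormSq := by
  have h : ∀ j l s, (S.conj U).volterraKernel j l s = S.volterraKernel j l s := fun j l s => by
    rw [volterraKernel, stateKernel_conj, volterraKernel, conj, Matrix.mul_assoc,
      ← Matrix.mul_assoc U.val, Units.mul_inv, Matrix.one_mul]
  simp only [h2NormSq, h]

/-- The error system changes coordinates by diag(1, U). This allows orthonormal bases to be chosen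
without continuity. -/
theorem h2NormSq_error_conj [DecidableEq ι] [DecidableEq κ] [Fintype ρ]
    (S : BilinearSystem ι μ ρ) (T : BilinearSystem κ μ ρ) (U : (Matrix κ κ ℝ)ˣ) :
    (S.error (T.conj U)).h2NormSq = (S.error T).h2NormSq := by
  let W : (Matrix (ι ⊕ κ) (ι ⊕ κ) ℝ)ˣ :=
    ⟨fromBlocks 1 0 0 U.val, fromBlocks 1 0 0 (U⁻¹ : (Matrix κ κ ℝ)ˣ).val,
      by simp [fromBlocks_multiply], by simp [fromBlocks_multiply]⟩
  have hW : W.val = fromBlocks 1 0 0 U.val := rfl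
  have hW' : (W⁻¹).val = fromBlocks 1 0 0 (U⁻¹ : (Matrix κ κ ℝ)ˣ).val := rfl
  have h : S.error (T.conj U) = (S.error T).conj W := by
    simp only [error, conj, hW, hW', fromBlocks_multiply, fromBlocks_mul_fromRows,
      fromCols_mul_fromBlocks]
    simp
  rw [h, h2NormSq_conj]

end BilinearSystem

/-! ### Stationarity under scaling and energies of projected Gramians. -/

namespace BilinearSystem

variable {ι κ κ' μ ρ α : Type*}

theorem tendsto_nhds_iff {f : α → BilinearSystem ι μ ρ} {l : Filter α}
    {T : BilinearSystem ι μ ρ} : Tendsto f l (𝓝 T) ↔ Tendsto (fun a => (f a).A) l (𝓝 T.A) ∧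
      Tendsto (fun a => (f a).N) l (𝓝 T.N) ∧ Tendsto (fun a => (f a).B) l (𝓝 T.B) ∧
        Tendsto (fun a => (f a).C) l (𝓝 T.C) := by
  rw [nhds_induced, tendsto_comap_iff, Prod.tendsto_iff, Prod.tendsto_iff, Prod.tendsto_iff]
  rfl

/-- The system with inputs and outputs scaled by `t`. -/
def scale (T : BilinearSystem ι μ ρ) (t : ℝ) : BilinearSystem ι μ ρ :=
  ⟨T.A, T.N, t • T.B, t • T.C⟩

theorem tendsto_scale (T : BilinearSystem ι μ ρ) : Tendsto T.scale (𝓝 1) (𝓝 T) := by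
  refine tendsto_nhds_iff.2 ⟨tendsto_const_nhds, tendsto_const_nhds, ?_, ?_⟩
  · have h : Continuous fun t : ℝ => t • T.B := by fun_prop
    simpa [scale] using h.tendsto 1
  · have h : Continuous fun t : ℝ => t • T.C := by fun_prop
    simpa [scale] using h.tendsto 1

variable [Fintype ι] [Fintype κ] [Fintype κ'] [Fintype μ] [Fintype ρ] [DecidableEq ι]
  [DecidableEq κ] [DecidableEq κ']
  {S : BilinearSystem ι μ ρ} {T : BilinearSystem κ μ ρ}

/-- At a local optimum the cross Gramian and the reduced Gramian have the same energy. -/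
theorem frob_eq_of_isLocalMin (hS : S.IsSymmetric) (hT : T.IsSymmetric) (hSS : S.Positive S)
    (hST : S.Positive T) (hTT : T.Positive T) (hSB : S.B = S.C.transpose)
    (hTB : T.B = T.C.transpose)
    (hmin : IsLocalMin (fun T : BilinearSystem κ μ ρ => (S.error T).h2NormSq) T)
    {Y : Matrix ι κ ℝ} {Z : Matrix κ κ ℝ} (hY : S.sylvesterOp T Y = S.B * T.B.transpose)
    (hZ : T.sylvesterOp T Z = T.B * T.B.transpose) :
    frob Y (S.B * T.B.transpose) = frob Z (T.B * T.B.transpose) := by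
  obtain ⟨X, hX⟩ := hSS.surjective (S.B * S.B.transpose)
  set c := frob X (S.B * S.B.transpose)
  set q := frob Y (S.B * T.B.transpose) with hq
  set p := frob Z (T.B * T.B.transpose) with hp
  -- Scaling B and C by t multiplies the cross Gramian by t and the reduced one by t²; pairing with
  -- the scaled inputs doubles these exponents.
  have hval : ∀ t : ℝ, 0 ≤ c - 2 * (t ^ 2 * q) + t ^ 4 * p ∧
      (S.error (T.scale t)).h2NormSq = ENNReal.ofReal (c - 2 * (t ^ 2 * q) + t ^ 4 * p) := by
    intro t
    have h := h2NormSq_error (T := T.scale t) hS ⟨hT.1, hT.2⟩ hSS hST hTT hSB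
      (by simp [scale, hTB]) (Y := t • Y) (Z := t ^ 2 • Z) hX
      ((map_smul (S.sylvesterOp T) t Y).trans (by rw [hY]; simp [scale]))
      ((map_smul (T.sylvesterOp T) (t ^ 2) Z).trans (by rw [hZ]; simp [scale, smul_smul, sq]))
    have h1 : frob (t • Y) (S.B * (T.scale t).B.transpose) = t ^ 2 * q := by
      simp [scale, hq]; ring
    have h2 : frob (t ^ 2 • Z) ((T.scale t).B * (T.scale t).B.transpose) = t ^ 4 * p := by
      simp [scale, hp]; ring
    rwa [h1, h2] at h
  have hone : T.scale 1 = T := by simp [scale]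
  have hloc : IsLocalMin (fun t : ℝ => c - 2 * (t ^ 2 * q) + t ^ 4 * p) 1 := by
    filter_upwards [T.tendsto_scale.eventually hmin] with t ht
    have h1 := (hval 1).2
    rw [hone] at h1
    rw [(hval t).2, h1] at ht
    exact (ENNReal.ofReal_le_ofReal_iff (hval t).1).1 ht
  have hder : HasDerivAt (fun t : ℝ => c - 2 * (t ^ 2 * q) + t ^ 4 * p) (-4 * q + 4 * p) 1 := by
    have h2 := (((hasDerivAt_pow 2 (1 : ℝ)).mul_const q).const_mul 2).const_sub c
    have h4 := (hasDerivAt_pow 4 (1 : ℝ)).mul_const p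
    refine (h2.add h4).congr_deriv ?_
    norm_num; ring
  have := hloc.hasDerivAt_eq_zero hder
  linarith

omit [Fintype ρ] in
theorem frob_sylvesterOp_project_right {U : Matrix ι κ ℝ} {W : Matrix ι κ' ℝ}
    (hU : U.transpose * U = 1) (hW : W.transpose * W = 1) (K L : Matrix κ κ' ℝ) :
    frob (U * K) (S.sylvesterOp (S.project W) (U * L)) =
      frob K ((S.project U).sylvesterOp (S.project W) L) := by
  have h := frob_sylvesterOp_project (S := S) (T := S) (U := (1 : Matrix ι ι ℝ)) (by simp) hW
    (U * K) (U * L)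
  rw [project_one, Matrix.one_mul, Matrix.one_mul] at h
  rw [h, frob_sylvesterOp_project hU hW]

omit [Fintype ρ] in
theorem Positive.project_right (hSS : S.Positive S) {W : Matrix ι κ ℝ}
    (hW : W.transpose * W = 1) : S.Positive (S.project W) := by
  have h := hSS.project (U := (1 : Matrix ι ι ℝ)) (by simp) hW
  rwa [project_one] at h

/-- The energy of the difference of the cross Gramian and the lifted reduced Gramian. -/
theorem frob_sylvesterOp_sub (hS : S.IsSymmetric) {U : Matrix ι κ ℝ}
    (hU : U.transpose * U = 1) {Y : Matrix ι κ ℝ} {Z : Matrix κ κ ℝ}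
    (hY : S.sylvesterOp (S.project U) Y = S.B * (S.project U).B.transpose)
    (hZ : (S.project U).sylvesterOp (S.project U) Z =
      (S.project U).B * (S.project U).B.transpose) :
    frob (Y - U * Z) (S.sylvesterOp (S.project U) (Y - U * Z)) =
      frob Y (S.B * (S.project U).B.transpose) -
        frob Z ((S.project U).B * (S.project U).B.transpose) := by
  -- Both ⟨U Z, M Y⟩ and ⟨U Z, M U Z⟩ equal p, so the square expands to q − 2p + p.
  have h1 := frob_sylvesterOp_comm hS (hS.project U) (U * Z) Y
  have h2 : frob (U * Z) (S.B * (S.project U).B.transpose) =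
      frob Z ((S.project U).B * (S.project U).B.transpose) := by
    rw [frob_comm, frob_mul_left, frob_comm, ← Matrix.mul_assoc]; rfl
  have h3 := frob_sylvesterOp_project_right (S := S) hU hU Z Z
  rw [hZ] at h3
  rw [hY] at h1
  rw [map_sub, map_sub, map_sub, LinearMap.sub_apply, LinearMap.sub_apply, hY, h2, h3,
    frob_comm Y (S.sylvesterOp _ _), ← h1, h2]
  ring

omit [DecidableEq ι] in
/-- The energy of `X - U K Wᵀ` in terms of the projected operators. -/
theorem energyInner_sub (hS : S.IsSymmetric) {X : Matrix ι ι ℝ} (hX : S.SolvesLyapunov X)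
    {U : Matrix ι κ ℝ} (hU : U.transpose * U = 1) {W : Matrix ι κ' ℝ}
    (hW : W.transpose * W = 1) (K : Matrix κ κ' ℝ) :
    energyInner S.A S.N (X - U * K * W.transpose) (X - U * K * W.transpose) =
      frob X (S.B * S.B.transpose) - (2 * frob K ((S.project U).B * (S.project W).B.transpose) -
        frob K ((S.project U).sylvesterOp (S.project W) K)) := by
  rw [solvesLyapunov_iff] at hX
  have h1 := frob_sylvesterOp_comm hS hS X (U * K * W.transpose)
  have h2 : frob (U * K * W.transpose) (S.B * S.B.transpose) =
      frob K ((S.project U).B * (S.project W).B.transpose) := by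
    rw [frob_comm, frob_mul_right, frob_mul_left, frob_comm, transpose_transpose]
    simp [project, transpose_mul, Matrix.mul_assoc]
  have h3 := frob_sylvesterOp_project (S := S) (T := S) hU hW K K
  rw [energyInner_eq_frob, map_sub, map_sub, map_sub, LinearMap.sub_apply, LinearMap.sub_apply,
    h1, h3, hX, frob_comm (S.B * _), h2]
  ring

omit [DecidableEq ι] in
/-- Two projected systems whose Gramians have at most energy `p` give an approximation of `X`
whose squared error is at least the one of a projected Gramian of energy `p`. -/
theorem energyInner_sub_le (hS : S.IsSymmetric) (hSS : S.Positive S)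
    (hSB : S.B = S.C.transpose) {X : Matrix ι ι ℝ} (hX : S.SolvesLyapunov X)
    {V U W : Matrix ι κ ℝ} (hV : V.transpose * V = 1) (hU : U.transpose * U = 1)
    (hW : W.transpose * W = 1) {Z ZU ZW : Matrix κ κ ℝ} (hZ : (S.project V).SolvesLyapunov Z)
    (hZU : (S.project U).SolvesLyapunov ZU) (hZW : (S.project W).SolvesLyapunov ZW)
    (hleU : frob ZU ((S.project U).B * (S.project U).B.transpose) ≤
      frob Z ((S.project V).B * (S.project V).B.transpose))
    (hleW : frob ZW ((S.project W).B * (S.project W).B.transpose) ≤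
      frob Z ((S.project V).B * (S.project V).B.transpose)) (K : Matrix κ κ ℝ) :
    energyInner S.A S.N (X - V * Z * V.transpose) (X - V * Z * V.transpose) ≤
      energyInner S.A S.N (X - U * K * W.transpose) (X - U * K * W.transpose) := by
  rw [energyInner_sub hS hX hV hV, energyInner_sub hS hX hU hW]
  rw [solvesLyapunov_iff] at hZ hZU hZW
  have hPUW := hSS.project hU hW
  obtain ⟨Y, hY⟩ := hPUW.surjective ((S.project U).B * (S.project W).B.transpose)
  have hCB : ∀ U : Matrix ι κ ℝ, (S.project U).B = (S.project U).C.transpose := fun U => by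
    simp [project, hSB, transpose_mul]
  -- For fixed U and W, the cross Gramian Y of the two projections is the best coefficient K.
  have h1 := hPUW.two_mul_sub_le (hS.project U) (hS.project W) hY K
  -- The squared H₂-distance of the two projections is nonnegative, which bounds twice the energy of
  -- Y by the sum of their energies.
  have h2 := (h2NormSq_error (hS.project U) (hS.project W) (hSS.project hU hU) hPUW
    (hSS.project hW hW) (hCB U) (hCB W) hZU hY hZW).1
  rw [hZ]
  linarith

/-- If a projected system has at least the `H₂`-error of another one, which is stationary, then
its Gramian has at most the energy of the other one. -/
theorem frob_le_of_h2NormSq_error_le (hS : S.IsSymmetric) (hSS : S.Positive S)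
    (hSB : S.B = S.C.transpose) {V U : Matrix ι κ ℝ} (hV : V.transpose * V = 1)
    (hU : U.transpose * U = 1) {Y : Matrix ι κ ℝ} {Z ZU : Matrix κ κ ℝ}
    (hY : S.sylvesterOp (S.project V) Y = S.B * (S.project V).B.transpose)
    (hZ : (S.project V).SolvesLyapunov Z) (hZU : (S.project U).SolvesLyapunov ZU)
    (hYZ : frob Y (S.B * (S.project V).B.transpose) =
      frob Z ((S.project V).B * (S.project V).B.transpose))
    (hle : (S.error (S.project V)).h2NormSq ≤ (S.error (S.project U)).h2NormSq) :
    frob ZU ((S.project U).B * (S.project U).B.transpose) ≤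
      frob Z ((S.project V).B * (S.project V).B.transpose) := by
  rw [solvesLyapunov_iff] at hZ hZU
  have hCB : ∀ U : Matrix ι κ ℝ, (S.project U).B = (S.project U).C.transpose := fun U => by
    simp [project, hSB, transpose_mul]
  obtain ⟨X, hX⟩ := hSS.surjective (S.B * S.B.transpose)
  obtain ⟨YU, hYU⟩ := (hSS.project_right hU).surjective (S.B * (S.project U).B.transpose)
  have h1 := h2NormSq_error hS (hS.project V) hSS (hSS.project_right hV) (hSS.project hV hV) hSB
    (hCB V) hX hY hZ
  have h2 := h2NormSq_error hS (hS.project U) hSS (hSS.project_right hU) (hSS.project hU hU) hSB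
    (hCB U) hX hYU hZU
  rw [h1.2, h2.2, ENNReal.ofReal_le_ofReal_iff h2.1] at hle
  -- The error is c − p at V and c − 2q_U + p_U at U, so 2q_U − p_U ≤ p; and q_U − p_U is an energy,
  -- so p_U ≤ q_U.
  have h3 := frob_sylvesterOp_sub hS hU hYU hZU
  have h4 := (hSS.project_right hU).nonneg (YU - U * ZU)
  linarith

/-- The projection of a system along a matrix with linearly independent columns. -/
noncomputable def obliqueProject (S : BilinearSystem ι μ ρ) (V : Matrix ι κ ℝ) :
    BilinearSystem κ μ ρ where
  A := (V.transpose * V)⁻¹ * (V.transpose * S.A * V)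
  N i := (V.transpose * V)⁻¹ * (V.transpose * S.N i * V)
  B := (V.transpose * V)⁻¹ * (V.transpose * S.B)
  C := S.C * V

omit [DecidableEq ι] in
theorem _root_.Matrix.tendsto_gram_inv_mul {σ : Type*} {V : Matrix ι κ ℝ}
    (hV : V.transpose * V = 1) {F : Matrix ι κ ℝ → Matrix κ σ ℝ} (hF : Continuous F) :
    Tendsto (fun U : Matrix ι κ ℝ => (U.transpose * U)⁻¹ * F U) (𝓝 V) (𝓝 (F V)) := by
  have h1 : ContinuousAt Inv.inv (1 : Matrix κ κ ℝ) := by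
    refine continuousAt_matrix_inv _ ?_
    rw [det_one, Ring.inverse_eq_inv']
    exact continuousAt_inv₀ one_ne_zero
  have h2 : Continuous fun U : Matrix ι κ ℝ => U.transpose * U := by fun_prop
  have h3 := h2.tendsto V
  rw [hV] at h3
  have h4 := h1.tendsto.comp h3
  rw [inv_one] at h4
  have h : Continuous fun p : Matrix κ κ ℝ × Matrix κ σ ℝ => p.1 * p.2 := by fun_prop
  have h5 := (h.tendsto (1, F V)).comp (h4.prodMk_nhds (hF.tendsto V))
  simpa [Function.comp_def] using h5

omit [Fintype μ] [Fintype ρ] [DecidableEq ι] in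
theorem tendsto_obliqueProject (S : BilinearSystem ι μ ρ) {V : Matrix ι κ ℝ}
    (hV : V.transpose * V = 1) : Tendsto S.obliqueProject (𝓝 V) (𝓝 (S.project V)) := by
  have hC : Continuous fun U : Matrix ι κ ℝ => S.C * U := by fun_prop
  exact tendsto_nhds_iff.2 ⟨tendsto_gram_inv_mul (F := fun U => U.transpose * S.A * U) hV
    (by fun_prop), tendsto_pi_nhds.2 fun i => tendsto_gram_inv_mul
      (F := fun U => U.transpose * S.N i * U) hV (by fun_prop),
    tendsto_gram_inv_mul (F := fun U => U.transpose * S.B) hV (by fun_prop), hC.tendsto V⟩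

omit [Fintype μ] [Fintype ρ] [DecidableEq ι] in
-- Factor VᵀV = QᵀQ; then V Q⁻¹ has orthonormal columns and spans the same space, so the two
-- projections differ only in coordinates.
theorem exists_project_eq_conj (S : BilinearSystem ι μ ρ) {V : Matrix ι κ ℝ}
    (hV : IsUnit (V.transpose * V)) : ∃ R : (Matrix κ κ ℝ)ˣ,
      (V * R.val).transpose * (V * R.val) = 1 ∧
        S.project (V * R.val) = (S.obliqueProject V).conj R := by
  have hpos : (V.transpose * V).PosSemidef := by
    simpa using posSemidef_mul_transpose V.transpose
  obtain ⟨P, hP⟩ := hpos.exists_eq_transpose_mul_self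
  have hPu : IsUnit P.det := by
    rw [isUnit_iff_isUnit_det, hP, det_mul] at hV
    exact isUnit_of_mul_isUnit_right hV
  obtain ⟨Q, rfl⟩ := (isUnit_iff_isUnit_det P).2 hPu
  have hPT : (Q⁻¹ : (Matrix κ κ ℝ)ˣ).val.transpose * Q.val.transpose = 1 := by
    rw [← transpose_mul, Units.mul_inv, transpose_one]
  have hinv : Q.val * (V.transpose * V)⁻¹ = (Q⁻¹ : (Matrix κ κ ℝ)ˣ).val.transpose := by
    rw [hP, Matrix.mul_inv_rev, ← coe_units_inv, ← Matrix.mul_assoc, Units.mul_inv,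
      Matrix.one_mul]
    exact inv_eq_left_inv hPT
  refine ⟨Q⁻¹, ?_, ?_⟩
  · rw [transpose_mul, Matrix.mul_assoc, ← Matrix.mul_assoc V.transpose, hP, Matrix.mul_assoc,
      Units.mul_inv, Matrix.mul_one, hPT]
  · simp only [project, conj, obliqueProject, inv_inv, ← Matrix.mul_assoc, hinv, transpose_mul]

end BilinearSystem

/-! ### Invertible reduced Gramian: nearby matrices of rank at most k. -/

namespace Matrix

variable {ι κ : Type*} [Fintype ι] [Fintype κ] [DecidableEq κ]

/-- If the orthonormal columns of `U` lie in the range of a matrix whose rank is at most their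
number, then they span this range. -/
theorem mul_transpose_mul_eq_of_rank_le {σ : Type*} [Fintype σ] {Z : Matrix ι σ ℝ}
    (hZ : Z.rank ≤ Fintype.card κ) {U : Matrix ι κ ℝ} (hU : U.transpose * U = 1)
    {D : Matrix σ κ ℝ} (hD : U = Z * D) : U * (U.transpose * Z) = Z := by
  classical
  have hinj : Function.Injective U.mulVecLin := fun x y hxy => by
    have h := congrArg (U.transpose *ᵥ ·) hxy
    simpa [mulVec_mulVec, hU] using h
  have hle : LinearMap.range U.mulVecLin ≤ LinearMap.range Z.mulVecLin := by
    rw [hD, mulVecLin_mul]; exact LinearMap.range_comp_le_range _ _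
  have hfin : Module.finrank ℝ (LinearMap.range U.mulVecLin) = Fintype.card κ := by
    rw [LinearMap.finrank_range_of_inj hinj, Module.finrank_fintype_fun_eq_card]
  have heq := Submodule.eq_of_le_of_finrank_le hle (hZ.trans hfin.ge)
  refine Matrix.ext_of_mulVec_single fun j => ?_
  have hmem : Z *ᵥ Pi.single j 1 ∈ LinearMap.range U.mulVecLin := heq ▸ ⟨Pi.single j 1, rfl⟩
  obtain ⟨w, hw⟩ := hmem
  rw [mulVecLin_apply] at hw
  rw [← mulVec_mulVec, ← mulVec_mulVec, ← hw, mulVec_mulVec w, hU, one_mulVec]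

end Matrix

namespace BilinearSystem

variable {ι κ μ ρ : Type*} [Fintype ι] [Fintype κ] [Fintype μ] [Fintype ρ] [DecidableEq ι]
  [DecidableEq κ] {S : BilinearSystem ι μ ρ} {V Y : Matrix ι κ ℝ} {Z : Matrix κ κ ℝ}

/-- Oblique projections depend continuously on U at V, so local optimality applies to them. The
orthonormalizing R need not be close to 1, because the H₂-error ignores coordinates. -/
theorem eventually_frob_le (hS : S.IsSymmetric) (hSS : S.Positive S)
    (hSB : S.B = S.C.transpose) (hV : V.transpose * V = 1)
    (hmin : IsLocalMin (fun T : BilinearSystem κ μ ρ => (S.error T).h2NormSq) (S.project V))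
    (hY : S.sylvesterOp (S.project V) Y = S.B * (S.project V).B.transpose)
    (hZ : (S.project V).SolvesLyapunov Z)
    (hYZ : frob Y (S.B * (S.project V).B.transpose) =
      frob Z ((S.project V).B * (S.project V).B.transpose)) :
    ∀ᶠ U in 𝓝 V, ∃ R : Matrix κ κ ℝ, (U * R).transpose * (U * R) = 1 ∧
      ∀ ZU, (S.project (U * R)).SolvesLyapunov ZU →
        frob ZU ((S.project (U * R)).B * (S.project (U * R)).B.transpose) ≤
          frob Z ((S.project V).B * (S.project V).B.transpose) := by
  have hdet : ∀ᶠ U in 𝓝 V, (U.transpose * U).det ≠ 0 := by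
    have h : Continuous fun U : Matrix ι κ ℝ => (U.transpose * U).det := by fun_prop
    exact (h.tendsto V).eventually_ne (by simp [hV])
  filter_upwards [hdet, (S.tendsto_obliqueProject hV).eventually hmin] with U hU hle
  obtain ⟨R, hR, heq⟩ := S.exists_project_eq_conj (V := U)
    ((isUnit_iff_isUnit_det _).2 (isUnit_iff_ne_zero.2 hU))
  refine ⟨R, hR, fun ZU hZU => ?_⟩
  refine frob_le_of_h2NormSq_error_le hS hSS hSB hV hR hY hZ hZU hYZ ?_
  rw [heq, h2NormSq_error_conj]
  exact hle

theorem eventually_energyInner_le_of_isUnit (hS : S.IsSymmetric) (hSS : S.Positive S)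
    (hSB : S.B = S.C.transpose) {X : Matrix ι ι ℝ} (hX : S.SolvesLyapunov X)
    (hV : V.transpose * V = 1)
    (hmin : IsLocalMin (fun T : BilinearSystem κ μ ρ => (S.error T).h2NormSq) (S.project V))
    (hY : S.sylvesterOp (S.project V) Y = S.B * (S.project V).B.transpose)
    (hZ : (S.project V).SolvesLyapunov Z)
    (hYZ : frob Y (S.B * (S.project V).B.transpose) =
      frob Z ((S.project V).B * (S.project V).B.transpose)) (hZs : Z.IsSymm) (hZu : IsUnit Z.det) :
    ∀ᶠ K in 𝓝 (V * Z * V.transpose), K.rank ≤ Fintype.card κ →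
      energyInner S.A S.N (X - V * Z * V.transpose) (X - V * Z * V.transpose) ≤
        energyInner S.A S.N (X - K) (X - K) := by
  have hev := eventually_frob_le hS hSS hSB hV hmin hY hZ hYZ
  -- Hence K (V Z⁻¹) is close to V for K close to V Z Vᵀ, with columns in the range of K. As Z is
  -- symmetric, the same holds for Kᵀ; K itself need not be symmetric, so two bases U and W are
  -- needed.
  have hval : V * Z * V.transpose * (V * Z⁻¹) = V := by
    rw [Matrix.mul_assoc, ← Matrix.mul_assoc V.transpose, hV, Matrix.one_mul, Matrix.mul_assoc,
      mul_nonsing_inv _ hZu, Matrix.mul_one]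
  have hsymm : (V * Z * V.transpose).transpose = V * Z * V.transpose := by
    simp [transpose_mul, hZs.eq, Matrix.mul_assoc]
  have hc1 : Continuous fun K : Matrix ι ι ℝ => K * (V * Z⁻¹) := by fun_prop
  have hc2 : Continuous fun K : Matrix ι ι ℝ => K.transpose * (V * Z⁻¹) := by fun_prop
  have h1 := hc1.tendsto (V * Z * V.transpose)
  have h2 := hc2.tendsto (V * Z * V.transpose)
  simp only [hsymm, hval] at h1 h2
  filter_upwards [h1.eventually hev, h2.eventually hev] with K ⟨R, hR, hRle⟩ ⟨Q, hQ, hQle⟩ hrank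
  set U := K * (V * Z⁻¹) * R with hU
  set W := K.transpose * (V * Z⁻¹) * Q with hW
  have hUK : U * (U.transpose * K) = K := mul_transpose_mul_eq_of_rank_le hrank hR
    (D := V * Z⁻¹ * R) (by rw [hU, Matrix.mul_assoc])
  have hWK : W * (W.transpose * K.transpose) = K.transpose :=
    mul_transpose_mul_eq_of_rank_le (by rwa [rank_transpose]) hQ
      (D := V * Z⁻¹ * Q) (by rw [hW, Matrix.mul_assoc])
  have hWK' : K * W * W.transpose = K := by
    have h := congrArg transpose hWK
    simpa [transpose_mul] using h
  have hK : U * (U.transpose * K * W) * W.transpose = K := by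
    rw [← Matrix.mul_assoc U, hUK, hWK']
  obtain ⟨ZU, hZU⟩ := (hSS.project hR hR).surjective ((S.project U).B * (S.project U).B.transpose)
  obtain ⟨ZW, hZW⟩ := (hSS.project hQ hQ).surjective ((S.project W).B * (S.project W).B.transpose)
  have hZU' := (solvesLyapunov_iff _ _).2 hZU
  have hZW' := (solvesLyapunov_iff _ _).2 hZW
  rw [← hK]
  exact energyInner_sub_le hS hSS hSB hX hV hR hQ hZ hZU' hZW' (hRle _ hZU') (hQle _ hZW') _

end BilinearSystem

/-! ### Singular reduced Gramian: coupling an idle state. -/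

namespace Matrix

variable {ι κ : Type*} [Fintype ι] [Fintype κ]

open scoped Matrix.Norms.Elementwise in
-- Positivity is an open condition, uniform over the compact unit sphere, and extends from it by
-- homogeneity.
theorem eventually_forall_frob_pos {L : ℝ → Matrix ι κ ℝ →ₗ[ℝ] Matrix ι κ ℝ}
    (hL : Continuous fun p : ℝ × Matrix ι κ ℝ => frob p.2 (L p.1 p.2))
    (h0 : ∀ Y, Y ≠ 0 → 0 < frob Y (L 0 Y)) :
    ∀ᶠ t in 𝓝 0, ∀ Y, Y ≠ 0 → 0 < frob Y (L t Y) := by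
  have hne : ∀ X ∈ Metric.sphere (0 : Matrix ι κ ℝ) 1, X ≠ 0 := by
    rintro X hX rfl; simp at hX
  have h := (isCompact_sphere (0 : Matrix ι κ ℝ) 1).eventually_forall_of_forall_eventually
    (x₀ := (0 : ℝ)) (P := fun t Y => 0 < frob Y (L t Y))
    fun Y hY => (hL.tendsto (0, Y)).eventually (lt_mem_nhds (h0 Y (hne Y hY)))
  filter_upwards [h] with t ht Y hY
  have hn : 0 < ‖Y‖ := norm_pos_iff.2 hY
  have h1 := ht (‖Y‖⁻¹ • Y) (by simp [norm_smul, hn.ne'])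
  simp only [map_smul, LinearMap.smul_apply, smul_eq_mul] at h1
  have h2 : 0 < ‖Y‖⁻¹ := inv_pos.2 hn
  exact pos_of_mul_pos_right (pos_of_mul_pos_right h1 h2.le) h2.le

/-- The symmetric matrix `e vᵀ + v eᵀ`. -/
def symmVecMulVec (e v : ι → ℝ) : Matrix ι ι ℝ := vecMulVec e v + vecMulVec v e

omit [Fintype ι] in
theorem isSymm_symmVecMulVec (e v : ι → ℝ) : (symmVecMulVec e v).IsSymm := by
  simp [symmVecMulVec, IsSymm, transpose_vecMulVec, add_comm]

omit [Fintype κ] in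
theorem mul_symmVecMulVec {W : Matrix κ ι ℝ} {e : ι → ℝ} (he : W *ᵥ e = 0) (v : ι → ℝ) :
    W * symmVecMulVec e v = vecMulVec (W *ᵥ v) e := by
  rw [symmVecMulVec, Matrix.mul_add, mul_vecMulVec, mul_vecMulVec, he, zero_vecMulVec, zero_add]

/-- The range of a symmetric matrix is the orthogonal complement of its kernel. -/
theorem IsSymm.exists_mulVec_eq {Z : Matrix ι ι ℝ} (hZ : Z.IsSymm) {r : ι → ℝ}
    (hr : ∀ v, Z *ᵥ v = 0 → v ⬝ᵥ r = 0) : ∃ h, Z *ᵥ h = r := by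
  classical
  have hsymm : (Matrix.toEuclideanLin Z).IsSymmetric :=
    isSymmetric_toEuclideanLin_iff.2 (by simpa [IsHermitian] using hZ.eq)
  have hmem : WithLp.toLp 2 r ∈ LinearMap.range (Matrix.toEuclideanLin Z) := by
    rw [← Submodule.orthogonal_orthogonal (LinearMap.range _), hsymm.orthogonal_range]
    intro v hv
    have hv' : Z *ᵥ v.ofLp = 0 := by
      have := congrArg WithLp.ofLp (LinearMap.mem_ker.1 hv)
      simpa using this
    rw [EuclideanSpace.inner_eq_star_dotProduct]
    simpa [dotProduct_comm] using hr _ hv'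
  obtain ⟨h, hh⟩ := hmem
  exact ⟨h.ofLp, by simpa using congrArg WithLp.ofLp hh⟩

end Matrix

namespace BilinearSystem

variable {ι κ μ ρ : Type*} [Fintype ι] [Fintype κ] [Fintype μ] {S : BilinearSystem ι μ ρ} {T : BilinearSystem κ μ ρ}

/-- A symmetric perturbation of a system that couples it to the direction `e`. -/
def perturb (T : BilinearSystem κ μ ρ) (e h : κ → ℝ) (g : μ → κ → ℝ) (b : ρ → ℝ) (t : ℝ) :
    BilinearSystem κ μ ρ where
  A := T.A + t • symmVecMulVec e h
  N i := T.N i + t • symmVecMulVec e (g i)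
  B := T.B + t • vecMulVec e b
  C := (T.B + t • vecMulVec e b).transpose

omit [Fintype κ] [Fintype μ] in
theorem tendsto_perturb (hTB : T.B = T.C.transpose) (e h : κ → ℝ) (g : μ → κ → ℝ) (b : ρ → ℝ) :
    Tendsto (T.perturb e h g b) (𝓝 0) (𝓝 T) := by
  refine tendsto_nhds_iff.2 ⟨?_, tendsto_pi_nhds.2 fun i => ?_, ?_, ?_⟩
  · have hc : Continuous fun t : ℝ => T.A + t • symmVecMulVec e h := by fun_prop
    simpa [perturb] using hc.tendsto 0
  · have hc : Continuous fun t : ℝ => T.N i + t • symmVecMulVec e (g i) := by fun_prop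
    simpa [perturb] using hc.tendsto 0
  · have hc : Continuous fun t : ℝ => T.B + t • vecMulVec e b := by fun_prop
    simpa [perturb] using hc.tendsto 0
  · have hc : Continuous fun t : ℝ => (T.B + t • vecMulVec e b).transpose := by fun_prop
    simpa [perturb, hTB] using hc.tendsto 0

omit [Fintype κ] [Fintype μ] in
theorem IsSymmetric.perturb (hT : T.IsSymmetric) (e h : κ → ℝ) (g : μ → κ → ℝ) (b : ρ → ℝ)
    (t : ℝ) : (T.perturb e h g b t).IsSymmetric where
  A_symm := hT.A_symm.add ((isSymm_symmVecMulVec e h).smul t)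
  N_symm i := (hT.N_symm i).add ((isSymm_symmVecMulVec e (g i)).smul t)

/-- The derivative of `sylvesterOp` in the direction of `perturb`. -/
def couplingOp (S : BilinearSystem ι μ ρ) (e h : κ → ℝ) (g : μ → κ → ℝ) :
    Matrix ι κ ℝ →ₗ[ℝ] Matrix ι κ ℝ :=
  sylvesterOp (⟨0, S.N, S.B, S.C⟩ : BilinearSystem ι μ ρ)
    (⟨symmVecMulVec e h, fun i => symmVecMulVec e (g i), 0, 0⟩ : BilinearSystem κ μ ρ)

theorem sylvesterOp_perturb (e h : κ → ℝ) (g : μ → κ → ℝ) (b : ρ → ℝ) (t : ℝ)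
    (W : Matrix ι κ ℝ) : S.sylvesterOp (T.perturb e h g b t) W =
      S.sylvesterOp T W + t • S.couplingOp e h g W := by
  simp only [couplingOp, sylvesterOp_apply, perturb, transpose_add, transpose_smul, Matrix.mul_add,
    Matrix.mul_smul, Finset.sum_add_distrib, ← Finset.smul_sum, Matrix.zero_mul, zero_add, smul_neg,
    smul_add]
  abel

/-- Only v eᵀ survives in each symmetric perturbation; the result has the form x eᵀ, orthogonal to
every matrix that kills e. -/
theorem couplingOp_apply_of_mulVec_eq_zero {W : Matrix ι κ ℝ} {e : κ → ℝ} (he : W *ᵥ e = 0)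
    (h : κ → ℝ) (g : μ → κ → ℝ) : S.couplingOp e h g W =
      -vecMulVec (W *ᵥ h + ∑ i, S.N i *ᵥ W *ᵥ g i) e := by
  have hsum : ∀ v : μ → ι → ℝ, vecMulVec (∑ i, v i) e = ∑ i, vecMulVec (v i) e := fun v => by
    ext a b; simp [vecMulVec_apply, Finset.sum_apply, Finset.sum_mul, Matrix.sum_apply]
  simp only [couplingOp, sylvesterOp_apply, (isSymm_symmVecMulVec _ _).eq, Matrix.zero_mul,
    zero_add, Matrix.mul_assoc, mul_symmVecMulVec he, mul_vecMulVec, add_vecMulVec, hsum]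

theorem frob_couplingOp_comm (hS : S.IsSymmetric) (e h : κ → ℝ) (g : μ → κ → ℝ)
    (X Y : Matrix ι κ ℝ) :
    frob X (S.couplingOp e h g Y) = frob (S.couplingOp e h g X) Y := by
  have h1 : (⟨0, S.N, S.B, S.C⟩ : BilinearSystem ι μ ρ).IsSymmetric := ⟨isSymm_zero, hS.N_symm⟩
  have h2 : (⟨symmVecMulVec e h, fun i => symmVecMulVec e (g i), 0, 0⟩ :
      BilinearSystem κ μ ρ).IsSymmetric :=
    ⟨isSymm_symmVecMulVec _ _, fun i => isSymm_symmVecMulVec _ _⟩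
  exact frob_sylvesterOp_comm h1 h2 X Y

theorem frob_vecMulVec_right (W : Matrix ι κ ℝ) (x : ι → ℝ) (y : κ → ℝ) :
    frob W (vecMulVec x y) = x ⬝ᵥ W *ᵥ y := by
  rw [frob_comm, frob_vecMulVec]

variable [Fintype ρ]

/-- A lower bound for the energy of the cross Gramian of a perturbed system. -/
theorem le_frob_cross_perturb (hS : S.IsSymmetric) (hT : T.IsSymmetric) {e h : κ → ℝ}
    {g : μ → κ → ℝ} {b : ρ → ℝ} {t : ℝ} (hpos : S.Positive (T.perturb e h g b t))
    {Y Y' Yt : Matrix ι κ ℝ} (hY : S.sylvesterOp T Y = S.B * T.B.transpose) (hYe : Y *ᵥ e = 0)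
    (hY' : S.sylvesterOp T Y' =
      vecMulVec (S.B *ᵥ b + (Y *ᵥ h + ∑ i, S.N i *ᵥ Y *ᵥ g i)) e)
    (hYt : S.sylvesterOp (T.perturb e h g b t) Yt =
      S.B * (T.perturb e h g b t).B.transpose) :
    frob Y (S.B * T.B.transpose) + t ^ 2 * frob Y' (S.sylvesterOp T Y') -
        t ^ 3 * frob Y' (S.couplingOp e h g Y') ≤
      frob Yt (S.B * (T.perturb e h g b t).B.transpose) := by
  set f := S.B *ᵥ b + (Y *ᵥ h + ∑ i, S.N i *ᵥ Y *ᵥ g i) with hf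
  have hB : S.B * (T.perturb e h g b t).B.transpose =
      S.B * T.B.transpose + t • vecMulVec (S.B *ᵥ b) e := by
    simp [perturb, Matrix.mul_add, transpose_vecMulVec, mul_vecMulVec]
  have hC : S.couplingOp e h g Y = vecMulVec (S.B *ᵥ b) e - vecMulVec f e := by
    rw [couplingOp_apply_of_mulVec_eq_zero hYe, ← sub_vecMulVec, ← neg_vecMulVec, hf]
    congr 1
    abel
  -- Y' is chosen to cancel the first-order residual f eᵀ, so the trial matrix Y + t Y' has only a
  -- defect of order t².
  have hW : S.sylvesterOp (T.perturb e h g b t) (Y + t • Y') =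
      S.B * (T.perturb e h g b t).B.transpose + t ^ 2 • S.couplingOp e h g Y' := by
    rw [sylvesterOp_perturb, hB]
    simp only [map_add, map_smul, hY, hY', hC, smul_add, smul_sub, smul_smul, sq]
    abel
  have h1 := hpos.two_mul_sub_le hS (hT.perturb e h g b t) hYt (Y + t • Y')
  have hCs := frob_couplingOp_comm hS e h g Y Y'
  have h2 : ∀ v, frob Y (vecMulVec v e) = 0 := fun v => by
    rw [frob_vecMulVec_right, hYe, dotProduct_zero]
  have h3 : frob Y' (S.B * T.B.transpose) = 0 := by
    rw [← hY, frob_sylvesterOp_comm hS hT, hY', frob_comm, h2]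
  rw [hW] at h1
  rw [hC] at hCs
  rw [hB] at h1 ⊢
  simp only [map_add, map_smul, map_sub, LinearMap.add_apply, LinearMap.smul_apply,
    LinearMap.sub_apply, smul_eq_mul, h2, h3, hCs] at h1
  rw [frob_comm (vecMulVec _ _) Y', frob_comm (vecMulVec _ _) Y'] at h1
  rw [hY']
  generalize frob Y' (vecMulVec f e) = x1 at *
  generalize frob Y' (vecMulVec (S.B *ᵥ b) e) = x2 at *
  generalize frob Y' (S.couplingOp e h g Y') = x3 at *
  simp only [map_add, map_smul, smul_eq_mul]
  linarith

/-- The Gramian of a system almost solves the Lyapunov equation of the perturbed system. -/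
theorem sylvesterOp_perturb_self {e h : κ → ℝ}
    {g : μ → κ → ℝ} {b : ρ → ℝ} (t : ℝ) {Z : Matrix κ κ ℝ}
    (hZ : T.sylvesterOp T Z = T.B * T.B.transpose) (hZs : Z.IsSymm) (hZe : Z *ᵥ e = 0)
    (hres : T.B *ᵥ b + (Z *ᵥ h + ∑ i, T.N i *ᵥ Z *ᵥ g i) = 0) :
    (T.perturb e h g b t).sylvesterOp (T.perturb e h g b t) Z =
      (T.perturb e h g b t).B * (T.perturb e h g b t).B.transpose -
        (t ^ 2 * (∑ i, g i ⬝ᵥ Z *ᵥ g i + b ⬝ᵥ b)) • vecMulVec e e := by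
  have hsum : Z *ᵥ h + ∑ i, T.N i *ᵥ Z *ᵥ g i = -(T.B *ᵥ b) := by
    rw [eq_neg_iff_add_eq_zero, add_comm, hres]
  have hC : T.couplingOp e h g Z = vecMulVec (T.B *ᵥ b) e := by
    rw [couplingOp_apply_of_mulVec_eq_zero hZe, hsum, neg_vecMulVec, neg_neg]
  have hE : ∀ i, (T.perturb e h g b t).N i *ᵥ Z *ᵥ g i =
      T.N i *ᵥ Z *ᵥ g i + (t * (g i ⬝ᵥ Z *ᵥ g i)) • e := fun i => by
    have h0 : e ⬝ᵥ Z *ᵥ g i = 0 := by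
      rw [dotProduct_mulVec, ← mulVec_transpose, hZs.eq, hZe, zero_dotProduct]
    simp only [perturb, add_mulVec, smul_mulVec, symmVecMulVec, vecMulVec_mulVec, h0]
    simp [smul_smul]
  have hC' : (T.perturb e h g b t).couplingOp e h g Z =
      vecMulVec (T.B *ᵥ b) e - (t * ∑ i, g i ⬝ᵥ Z *ᵥ g i) • vecMulVec e e := by
    rw [couplingOp_apply_of_mulVec_eq_zero hZe]
    simp only [hE, Finset.sum_add_distrib, ← Finset.sum_smul, ← Finset.mul_sum]
    rw [← add_assoc, hsum, add_vecMulVec, neg_vecMulVec, smul_vecMulVec]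
    abel
  -- Both arguments of the operator are perturbed; they are handled one at a time, with a transpose
  -- in between.
  rw [sylvesterOp_perturb, hC', ← transpose_transpose ((T.perturb e h g b t).sylvesterOp T Z),
    sylvesterOp_transpose, hZs.eq, sylvesterOp_perturb, hC, hZ]
  simp only [perturb, transpose_add, transpose_smul, transpose_mul, transpose_transpose,
    transpose_vecMulVec, Matrix.add_mul, Matrix.mul_add, Matrix.smul_mul, Matrix.mul_smul,
    mul_vecMulVec, vecMulVec_mul, vecMul_transpose]
  ext i j
  simp only [add_mulVec, smul_mulVec, vecMulVec_mulVec, Matrix.add_apply, Matrix.sub_apply,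
    Matrix.smul_apply, vecMulVec_apply, Pi.add_apply, Pi.smul_apply, smul_eq_mul,
    MulOpposite.smul_eq_mul_unop, MulOpposite.unop_op]
  ring

/-- The energy of the Gramian of a perturbed system differs from the one of the system by a term
of fourth order. -/
theorem exists_frob_gramian_perturb_le (hT : T.IsSymmetric) (hTT : T.Positive T) {e h : κ → ℝ}
    {g : μ → κ → ℝ} {b : ρ → ℝ} {Z : Matrix κ κ ℝ}
    (hZ : T.sylvesterOp T Z = T.B * T.B.transpose) (hZs : Z.IsSymm) (hZe : Z *ᵥ e = 0)
    (hres : T.B *ᵥ b + (Z *ᵥ h + ∑ i, T.N i *ᵥ Z *ᵥ g i) = 0) :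
    ∃ c : ℝ, ∀ᶠ t in 𝓝 (0 : ℝ), (T.perturb e h g b t).Positive (T.perturb e h g b t) ∧
      ∀ Zt, (T.perturb e h g b t).sylvesterOp (T.perturb e h g b t) Zt =
          (T.perturb e h g b t).B * (T.perturb e h g b t).B.transpose →
        frob Zt ((T.perturb e h g b t).B * (T.perturb e h g b t).B.transpose) ≤
          frob Z (T.B * T.B.transpose) + t ^ 4 * c := by
  obtain ⟨R, hR⟩ := hTT.surjective (vecMulVec e e)
  set θ := ∑ i, g i ⬝ᵥ Z *ᵥ g i + b ⬝ᵥ b with hθ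
  refine ⟨θ ^ 2 * (2 * frob R (vecMulVec e e)), ?_⟩
  -- Keeping the perturbed form above half of the original one bounds the energy of Rt uniformly in
  -- t.
  have hev := eventually_forall_frob_pos (ι := κ) (κ := κ)
    (L := fun t => (T.perturb e h g b t).sylvesterOp (T.perturb e h g b t) -
      (1 / 2 : ℝ) • T.sylvesterOp T) (by
        simp only [frob_apply, LinearMap.sub_apply, LinearMap.smul_apply, sylvesterOp_apply, perturb]
        fun_prop) (fun Y hY => by
        have h0 : T.perturb e h g b 0 = ⟨T.A, T.N, T.B, T.B.transpose⟩ := by simp [perturb]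
        have h1 : (T.perturb e h g b 0).sylvesterOp (T.perturb e h g b 0) = T.sylvesterOp T := by
          rw [h0]; rfl
        have h2 := hTT Y hY
        simp only [h1, LinearMap.sub_apply, LinearMap.smul_apply, map_sub, map_smul, smul_eq_mul]
        linarith)
  filter_upwards [hev] with t ht
  have hpos : (T.perturb e h g b t).Positive (T.perturb e h g b t) := fun Y hY => by
    have h1 := ht Y hY
    have h2 := hTT Y hY
    simp only [LinearMap.sub_apply, LinearMap.smul_apply, map_sub, map_smul, smul_eq_mul] at h1
    linarith
  refine ⟨hpos, fun Zt hZt => ?_⟩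
  have hTt := hT.perturb e h g b t
  obtain ⟨Rt, hRt⟩ := hpos.surjective (vecMulVec e e)
  have hZ' := sylvesterOp_perturb_self t hZ hZs hZe hres
  rw [← hθ] at hZ'
  have hZt' : Zt = Z + (t ^ 2 * θ) • Rt := by
    apply hpos.injective
    rw [map_add, map_smul, hZt, hZ', hRt]; abel
  have hbound : frob Rt (vecMulVec e e) ≤ 2 * frob R (vecMulVec e e) := by
    have h1 : 0 ≤ frob Rt (vecMulVec e e) - 1 / 2 * frob Rt (T.sylvesterOp T Rt) := by
      rcases eq_or_ne Rt 0 with h0 | h0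
      · simp [h0]
      · have := ht Rt h0
        simp only [LinearMap.sub_apply, LinearMap.smul_apply, map_sub, map_smul, smul_eq_mul,
          hRt] at this
        exact this.le
    have h2 := hTT.nonneg (Rt - (2 : ℝ) • R)
    have h3 := frob_sylvesterOp_comm hT hT R Rt
    simp only [map_sub, map_smul, LinearMap.sub_apply, LinearMap.smul_apply, smul_eq_mul, hR]
      at h2 h3
    rw [frob_comm _ Rt] at h3
    linarith
  have hZe' : ∀ v, frob Z (vecMulVec v e) = 0 := fun v => by
    rw [frob_vecMulVec_right, hZe, dotProduct_zero]
  have hZB : frob Z ((T.perturb e h g b t).B * (T.perturb e h g b t).B.transpose) =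
      frob Z (T.B * T.B.transpose) := by
    have h1 : ∀ v, frob Z (vecMulVec e v) = 0 := fun v => by
      rw [← frob_transpose, transpose_vecMulVec, hZs.eq, hZe']
    simp [perturb, Matrix.add_mul, Matrix.mul_add, transpose_vecMulVec, mul_vecMulVec,
      vecMulVec_mul, hZe', h1]
  -- The correction of the Gramian already carries t²θ. Its pairing with the inputs yields another
  -- t²θ, since Z is orthogonal to e eᵀ.
  have hRB : frob Rt ((T.perturb e h g b t).B * (T.perturb e h g b t).B.transpose) =
      t ^ 2 * θ * frob Rt (vecMulVec e e) := by
    rw [sub_eq_iff_eq_add.1 hZ'.symm, map_add, frob_sylvesterOp_comm hTt hTt, hRt, frob_comm,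
      hZe', map_smul, zero_add, smul_eq_mul]
  rw [hZt', map_add, LinearMap.add_apply, map_smul, LinearMap.smul_apply, smul_eq_mul, hZB, hRB]
  have h4 : t ^ 2 * θ * (t ^ 2 * θ * frob Rt (vecMulVec e e)) ≤
      t ^ 4 * (θ ^ 2 * (2 * frob R (vecMulVec e e))) := by
    have := mul_le_mul_of_nonneg_left hbound (by positivity : 0 ≤ t ^ 4 * θ ^ 2)
    linarith
  linarith

variable [DecidableEq ι] [DecidableEq κ]

/-- At a local optimum whose Gramians vanish on `e`, the residual of the cross Gramian vanishes if
the one of the reduced Gramian does. -/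
theorem mulVec_add_eq_zero_of_isLocalMin (hS : S.IsSymmetric) (hT : T.IsSymmetric)
    (hSS : S.Positive S) (hST : S.Positive T) (hTT : T.Positive T) (hSB : S.B = S.C.transpose)
    (hTB : T.B = T.C.transpose)
    (hmin : IsLocalMin (fun T : BilinearSystem κ μ ρ => (S.error T).h2NormSq) T)
    {Y : Matrix ι κ ℝ} {Z : Matrix κ κ ℝ} (hY : S.sylvesterOp T Y = S.B * T.B.transpose)
    (hZ : T.sylvesterOp T Z = T.B * T.B.transpose) (hZs : Z.IsSymm) {e : κ → ℝ} (he : e ≠ 0)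
    (hYe : Y *ᵥ e = 0) (hZe : Z *ᵥ e = 0) {h : κ → ℝ} {g : μ → κ → ℝ} {b : ρ → ℝ}
    (hres : T.B *ᵥ b + (Z *ᵥ h + ∑ i, T.N i *ᵥ Z *ᵥ g i) = 0) :
    S.B *ᵥ b + (Y *ᵥ h + ∑ i, S.N i *ᵥ Y *ᵥ g i) = 0 := by
  obtain ⟨X, hX⟩ := hSS.surjective (S.B * S.B.transpose)
  obtain ⟨Y', hY'⟩ := hST.surjective
    (vecMulVec (S.B *ᵥ b + (Y *ᵥ h + ∑ i, S.N i *ᵥ Y *ᵥ g i)) e)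
  obtain ⟨c, hc⟩ := exists_frob_gramian_perturb_le hT hTT hZ hZs hZe hres
  set δ := frob Y' (S.sylvesterOp T Y') with hδ
  set τ := frob Y' (S.couplingOp e h g Y') with hτ
  have hev : ∀ᶠ t in 𝓝 (0 : ℝ), S.Positive (T.perturb e h g b t) :=
    eventually_forall_frob_pos (L := fun t => S.sylvesterOp (T.perturb e h g b t)) (by
        simp only [frob_apply, sylvesterOp_apply, perturb]
        fun_prop) (fun Y hY => by
        simp only [sylvesterOp_perturb, zero_smul, add_zero]
        exact hST Y hY)
  have hval := (h2NormSq_error hS hT hSS hST hTT hSB hTB hX hY hZ).2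
  -- The gain 2t²δ in the cross term must not exceed the remaining terms of order t³ and t⁴;
  -- dividing by t² forces the energy δ of Y' to vanish.
  have hle : ∀ᶠ t in 𝓝 (0 : ℝ), t ^ 2 * δ ≤ t ^ 3 * τ + t ^ 4 * (c / 2) := by
    filter_upwards [hc, hev, (tendsto_perturb hTB e h g b).eventually hmin] with t hct hpos ht
    obtain ⟨Yt, hYt⟩ := hpos.surjective (S.B * (T.perturb e h g b t).B.transpose)
    obtain ⟨Zt, hZt⟩ := hct.1.surjective
      ((T.perturb e h g b t).B * (T.perturb e h g b t).B.transpose)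
    have h1 := h2NormSq_error hS (hT.perturb e h g b t) hSS hpos hct.1 hSB
      (by simp [perturb]) hX hYt hZt
    have h2 := le_frob_cross_perturb hS hT hpos hY hYe hY' hYt
    have h3 := hct.2 Zt hZt
    rw [hval, h1.2, ENNReal.ofReal_le_ofReal_iff h1.1] at ht
    linarith
  have hδ0 : δ ≤ 0 := by
    have hlim : Tendsto (fun t : ℝ => t * τ + t ^ 2 * (c / 2)) (𝓝[≠] 0) (𝓝 0) := by
      have hcont : Continuous fun t : ℝ => t * τ + t ^ 2 * (c / 2) := by fun_prop
      simpa using (hcont.tendsto 0).mono_left nhdsWithin_le_nhds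
    refine ge_of_tendsto hlim ?_
    filter_upwards [hle.filter_mono nhdsWithin_le_nhds, self_mem_nhdsWithin] with t ht ht0
    have : 0 < t ^ 2 := sq_pos_of_ne_zero ht0
    refine le_of_mul_le_mul_left ?_ this
    linarith
  have hY0 := hST.eq_zero hδ0
  rw [hY0, map_zero, eq_comm] at hY'
  obtain ⟨a, ha⟩ := Function.ne_iff.1 he
  ext i
  have hia := congrFun (congrFun hY' i) a
  exact (mul_eq_zero.1 hia).resolve_right ha

end BilinearSystem

/-! ### Singular reduced Gramian: exact recovery. -/

namespace BilinearSystem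

variable {ι κ μ ρ : Type*} [Fintype ι] [Fintype κ] [Fintype μ] [Fintype ρ]
  {S : BilinearSystem ι μ ρ} {T : BilinearSystem κ μ ρ}

/-- The kernel of the Gramian of a symmetric system is unreachable. -/
theorem mulVec_eq_zero_of_gramian_mulVec_eq_zero (hT : T.IsSymmetric) {Z : Matrix κ κ ℝ}
    (hZ : T.sylvesterOp T Z = T.B * T.B.transpose) (hpos : Z.PosSemidef) {v : κ → ℝ}
    (hv : Z *ᵥ v = 0) : T.B.transpose *ᵥ v = 0 ∧ ∀ i, Z *ᵥ T.N i *ᵥ v = 0 := by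
  have hZs : Z.transpose = Z := by simpa using hpos.1.eq
  have hvZ : v ᵥ* Z = 0 := by rw [← mulVec_transpose, hZs, hv]
  -- Tested on v, the A-terms vanish and the equation equates minus a sum of nonnegative terms with
  -- |Bᵀv|².
  have h := congrArg (fun K => v ⬝ᵥ K *ᵥ v) hZ
  have hNi : ∀ i, v ⬝ᵥ (T.N i * Z * (T.N i).transpose) *ᵥ v = (T.N i *ᵥ v) ⬝ᵥ Z *ᵥ T.N i *ᵥ v :=
    fun i => by
      rw [(hT.N_symm i).eq, ← mulVec_mulVec, ← mulVec_mulVec, dotProduct_mulVec,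
        ← mulVec_transpose, (hT.N_symm i).eq]
  have hB : v ⬝ᵥ (T.B * T.B.transpose) *ᵥ v = (T.B.transpose *ᵥ v) ⬝ᵥ (T.B.transpose *ᵥ v) := by
    rw [← mulVec_mulVec, dotProduct_mulVec, ← mulVec_transpose]
  have hAZ : v ⬝ᵥ (T.A * Z) *ᵥ v = 0 := by
    rw [← mulVec_mulVec, hv, mulVec_zero, dotProduct_zero]
  have hZA : v ⬝ᵥ (Z * T.A.transpose) *ᵥ v = 0 := by
    rw [← mulVec_mulVec, dotProduct_mulVec, hvZ, zero_dotProduct]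
  simp only [sylvesterOp_apply, neg_mulVec, add_mulVec, sum_mulVec, dotProduct_neg,
    dotProduct_add, dotProduct_sum, hNi, hAZ, hZA, hB, zero_add] at h
  have hnn : ∀ i, 0 ≤ (T.N i *ᵥ v) ⬝ᵥ Z *ᵥ T.N i *ᵥ v := fun i => by
    simpa using hpos.dotProduct_mulVec_nonneg (T.N i *ᵥ v)
  have hBnn : 0 ≤ (T.B.transpose *ᵥ v) ⬝ᵥ (T.B.transpose *ᵥ v) := by
    simpa using dotProduct_star_self_nonneg (T.B.transpose *ᵥ v)
  have hsum := Finset.sum_nonneg fun i (_ : i ∈ Finset.univ) => hnn i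
  refine ⟨dotProduct_self_eq_zero.1 (by linarith), fun i => ?_⟩
  have hi := (Finset.sum_eq_zero_iff_of_nonneg fun i _ => hnn i).1 (by linarith) i
    (Finset.mem_univ i)
  exact (hpos.dotProduct_mulVec_zero_iff _).1 (by simpa using hi)

variable [DecidableEq ι] [DecidableEq κ]

/-- A locally optimal projection whose Gramian is singular reproduces the Gramian exactly. -/
theorem eq_of_isLocalMin_of_singular (hS : S.IsSymmetric) (hSS : S.Positive S)
    (hSB : S.B = S.C.transpose) {X : Matrix ι ι ℝ} (hX : S.SolvesLyapunov X)
    {V : Matrix ι κ ℝ} (hV : V.transpose * V = 1)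
    (hmin : IsLocalMin (fun T : BilinearSystem κ μ ρ => (S.error T).h2NormSq) (S.project V))
    {Z : Matrix κ κ ℝ} (hZ : (S.project V).SolvesLyapunov Z) (hpos : Z.PosSemidef)
    (hY : S.sylvesterOp (S.project V) (V * Z) = S.B * (S.project V).B.transpose)
    {e : κ → ℝ} (he : e ≠ 0) (hZe : Z *ᵥ e = 0) : X = V * Z * V.transpose := by
  rw [solvesLyapunov_iff] at hX hZ
  have hZs : Z.IsSymm := by simpa [IsHermitian, IsSymm] using hpos.1
  have hT := hS.project V
  have hVB : ∀ b, V.transpose *ᵥ S.B *ᵥ b = (S.project V).B *ᵥ b := fun b => by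
    simp [project]
  have hVN : ∀ i x, V.transpose *ᵥ S.N i *ᵥ V *ᵥ x = (S.project V).N i *ᵥ x := fun i x => by
    simp [project, Matrix.mul_assoc]
  set P := V * V.transpose with hP
  -- Given any b and g, some h makes the reduced residual vanish, as its other terms are orthogonal
  -- to ker Z. The full residual then vanishes too, which expresses this vector as −V Z h.
  have key : ∀ (b : ρ → ℝ) (g : μ → κ → ℝ),
      P *ᵥ (S.B *ᵥ b + ∑ i, S.N i *ᵥ (V * Z) *ᵥ g i) =
        S.B *ᵥ b + ∑ i, S.N i *ᵥ (V * Z) *ᵥ g i := by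
    intro b g
    obtain ⟨h, hh⟩ := hZs.exists_mulVec_eq
      (r := -((S.project V).B *ᵥ b + ∑ i, (S.project V).N i *ᵥ Z *ᵥ g i)) fun v hv => by
        obtain ⟨h1, h2⟩ := mulVec_eq_zero_of_gramian_mulVec_eq_zero hT hZ hpos hv
        have h3 : v ⬝ᵥ (S.project V).B *ᵥ b = 0 := by
          rw [dotProduct_mulVec, ← mulVec_transpose, h1, zero_dotProduct]
        have h4 : ∀ i, v ⬝ᵥ (S.project V).N i *ᵥ Z *ᵥ g i = 0 := fun i => by
          rw [dotProduct_mulVec, ← mulVec_transpose, (hT.N_symm i).eq, dotProduct_mulVec,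
            ← mulVec_transpose, hZs.eq, h2, zero_dotProduct]
        simp only [dotProduct_neg, dotProduct_add, dotProduct_sum, h3, h4,
          Finset.sum_const_zero, add_zero, neg_zero]
    have hf := mulVec_add_eq_zero_of_isLocalMin hS hT hSS (hSS.project_right hV)
      (hSS.project hV hV) hSB (by simp [project, hSB, transpose_mul]) hmin hY hZ hZs he
      (by rw [← mulVec_mulVec, hZe, mulVec_zero]) hZe (h := h) (g := g) (b := b)
      (by rw [hh]; abel)
    have hf' : S.B *ᵥ b + ∑ i, S.N i *ᵥ (V * Z) *ᵥ g i = -(V *ᵥ Z *ᵥ h) := by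
      rw [eq_neg_iff_add_eq_zero, mulVec_mulVec, ← hf]; abel
    rw [hf', mulVec_neg, mulVec_mulVec (Z *ᵥ h), hP, Matrix.mul_assoc, hV, Matrix.mul_one]
  have hPB : P * S.B = S.B := by
    classical
    refine Matrix.ext_of_mulVec_single fun j => ?_
    have h := key (Pi.single j 1) 0
    rw [← mulVec_mulVec]
    simpa using h
  have hPN : ∀ i, P * (S.N i * (V * Z)) = S.N i * (V * Z) := fun i => by
    classical
    refine Matrix.ext_of_mulVec_single fun j => ?_
    have h := key 0 (Pi.single i (Pi.single j 1))
    rw [Finset.sum_eq_single i (fun a _ ha => by simp [Pi.single_eq_of_ne ha]) (by simp)] at h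
    rw [← mulVec_mulVec, ← mulVec_mulVec (Pi.single j 1) (S.N i) (V * Z)]
    simpa only [Pi.single_eq_same, mulVec_zero, zero_add] using h
  have hPV : P * V = V := by rw [hP, Matrix.mul_assoc, hV, Matrix.mul_one]
  have hPs : P.transpose = P := by rw [hP, transpose_mul, transpose_transpose]
  -- The Sylvester equation of V Z puts A V Z into the range of V as well.
  have hYeq : S.A * (V * Z) = -(V * Z * (S.project V).A.transpose +
      ∑ i, S.N i * (V * Z) * ((S.project V).N i).transpose +
        S.B * (S.project V).B.transpose) := by
    rw [← hY, sylvesterOp_apply]; abel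
  have hPA : P * (S.A * (V * Z)) = S.A * (V * Z) := by
    rw [hYeq, Matrix.mul_neg, Matrix.mul_add, Matrix.mul_add, Matrix.mul_sum,
      ← Matrix.mul_assoc P, ← Matrix.mul_assoc P V, hPV, ← Matrix.mul_assoc P, hPB]
    simp only [← Matrix.mul_assoc P (S.N _ * (V * Z)), hPN]
  have hright : ∀ M : Matrix ι ι ℝ, P * (M * (V * Z)) = M * (V * Z) →
      Z * (V.transpose * (M.transpose * P)) = Z * (V.transpose * M.transpose) := fun M hM => by
    have h := congrArg transpose hM
    simpa [transpose_mul, hPs, hZs.eq, Matrix.mul_assoc] using h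
  have hBP : S.B.transpose * P = S.B.transpose := by
    have h := congrArg transpose hPB
    rwa [transpose_mul, hPs] at h
  have h1 : V * Z * (S.project V).A.transpose * V.transpose = V * Z * V.transpose *
      S.A.transpose := by
    have h := hright _ hPA
    rw [hP] at h
    simp only [project, transpose_mul, transpose_transpose, Matrix.mul_assoc, h]
  have h2 : ∀ i, S.N i * (V * Z) * ((S.project V).N i).transpose * V.transpose =
      S.N i * (V * Z * V.transpose) * (S.N i).transpose := fun i => by
    have h := hright _ (hPN i)
    rw [hP] at h
    simp only [project, transpose_mul, transpose_transpose, Matrix.mul_assoc, h]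
  have h3 : S.B * (S.project V).B.transpose * V.transpose = S.B * S.B.transpose := by
    rw [hP] at hBP
    simp only [project, transpose_mul, transpose_transpose, Matrix.mul_assoc, hBP]
  -- Multiplied by Vᵀ on the right, the Sylvester equation of V Z becomes the Lyapunov equation of
  -- X, because P can be dropped everywhere.
  apply hSS.injective
  rw [hX, sylvesterOp_apply, ← Matrix.mul_assoc, hYeq, Matrix.neg_mul, Matrix.add_mul,
    Matrix.add_mul, Matrix.sum_mul, h1, h3]
  simp only [h2]
  abel

end BilinearSystem

/-! ### The theorem. -/

theorem mainTheorem2 {n m r k : ℕ} (hk : k < n)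
    (S : BilinearSystem (Fin n) (Fin m) (Fin r))
    (hA : S.A.IsSymm) (hAneg : (-S.A).PosDef) (hN : ∀ i, (S.N i).IsSymm)
    (hBC : S.B = S.C.transpose)
    (hρ : realSpectralRadius (Ring.inverse (lyapunovOp S.A) * correctionOp S.N) < 1)
    (V : Matrix (Fin n) (Fin k) ℝ) (hV : V.transpose * V = 1)
    (X : Matrix (Fin n) (Fin n) ℝ) (hX : S.SolvesLyapunov X)
    (Xhat : Matrix (Fin k) (Fin k) ℝ) (hXhat : (S.project V).SolvesLyapunov Xhat)
    (hopt : S.IsLocallyH2Optimal (S.project V)) :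
    IsLocalMinOn (fun Z : Matrix (Fin n) (Fin n) ℝ => energyNorm S.A S.N (X - Z))
      {Z | Z.rank ≤ k} (V * Xhat * V.transpose) := by
  have hS : S.IsSymmetric := ⟨hA, hN⟩
  have hSS := BilinearSystem.positive_of_realSpectralRadius_lt_one hS hAneg hρ
  have hT := hS.project V
  have hTT := hSS.project hV hV
  have hTB : (S.project V).B = (S.project V).C.transpose := by
    simp [BilinearSystem.project, hBC, transpose_mul]
  have hmin := hopt.2
  have hZ := (BilinearSystem.solvesLyapunov_iff _ _).1 hXhat
  obtain ⟨Y, hY⟩ := (hSS.project_right hV).surjective (S.B * (S.project V).B.transpose)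
  have hYZ := BilinearSystem.frob_eq_of_isLocalMin hS hT hSS (hSS.project_right hV) hTT hBC hTB
    hmin hY hZ
  have hpos := (BilinearSystem.h2NormSq_eq hT hTT hZ).1
  -- The energy of the difference is q − p, which is zero by stationarity.
  have hYV : Y = V * Xhat := by
    have h := BilinearSystem.frob_sylvesterOp_sub hS hV hY hZ
    exact sub_eq_zero.1 ((hSS.project_right hV).eq_zero (by rw [h, hYZ, sub_self]))
  have hnorm : ∀ {Z Z' : Matrix (Fin n) (Fin n) ℝ},
      energyInner S.A S.N (X - Z) (X - Z) ≤ energyInner S.A S.N (X - Z') (X - Z') →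
        energyNorm S.A S.N (X - Z) ≤ energyNorm S.A S.N (X - Z') := fun h => Real.sqrt_le_sqrt h
  by_cases hu : IsUnit Xhat.det
  · have hsymm : Xhat.IsSymm := by simpa [IsHermitian, IsSymm] using hpos.1
    have h := BilinearSystem.eventually_energyInner_le_of_isUnit hS hSS hBC hX hV hmin hY hXhat
      hYZ hsymm hu
    rw [Fintype.card_fin] at h
    exact eventually_nhdsWithin_iff.2 (h.mono fun Z hZ hr => hnorm (hZ hr))
  · obtain ⟨e, he, hZe⟩ := exists_mulVec_eq_zero_iff.2 (by simpa using hu)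
    have hXV := BilinearSystem.eq_of_isLocalMin_of_singular hS hSS hBC hX hV hmin hXhat hpos
      (hYV ▸ hY) he hZe
    -- Here the error of V X̂ Vᵀ is zero, so the minimum is even global.
    refine Eventually.of_forall fun Z => ?_
    rw [← hXV]
    simp [energyNorm, energyInner]
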